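/- Let $P$ be a pair of pants, $\pi_1(P)=\langle\alpha,\beta,\gamma\mid\alpha\beta\gamma=1\rangle$ with $\alpha,\beta,\gamma$ peripheral. A framed representation is a homomorphism $\rho\colon\pi_1(P)\to \mathrm{PSL}_3(\mathbb R)=\mathrm{SL}_3(\mathbb R)$ together with full flags $A,B,C$ in $\mathbb{RP}^2$ fixed by $\rho(\alpha),\rho(\beta),\rho(\gamma)$ respectively; framed representations are considered up to conjugation. For flags $F_i=(p_i,\ell_i)$ (a point on a line) put $$\mathsf{cr}_1(F_1,F_2,F_3,F_4)=-\frac{\ell_1(p_2)\,\overline{p_1p_3}(p_4)}{\ell_1(p_4)\,\overline{p_1p_3}(p_2)},\quad \mathsf{cr}_2(F_1,F_2,F_3,F_4)=-\frac{\ell_3(p_4)\,\overline{p_1p_3}(p_2)}{\ell_3(p_2)\,\overline{p_1p_3}(p_4)},\quad \mathsf T(F_1,F_2,F_3)=\frac{\ell_1(p_2)\ell_2(p_3)\ell_3(p_1)}{\ell_1(p_3)\ell_2(p_1)\ell_3(p_2)} .$$ The Fock--Goncharov coordinates of $[\rho,A,B,C]$ for the ideal triangulation of $P$ by two triangles are $\sigma_1,\sigma_2=\mathsf{cr}_1,\mathsf{cr}_2$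 of $(A,\rho(\alpha)B,C,B)$; $\sigma_4,\sigma_3=\mathsf{cr}_1,\mathsf{cr}_2$ of $(A,C,B,\rho(\alpha)^{-1}C)$; $\sigma_6,\sigma_5=\mathsf{cr}_1,\mathsf{cr}_2$ of $(B,A,C,\rho(\gamma)A)$; $\tau_1=\mathsf T(A,C,B)$, $\tau_2=\mathsf T(A,\rho(\alpha)B,C)$. Let $\widehat{\mathfrak C}(P)$ be the space of classes of framed representations all of whose coordinates are positive (the positive framed representations, i.e. the framed convex projective structures on $P$). The coordinates identify $\widehat{\mathfrak C}(P)$ bijectively with $\mathbb R^8_{>0}$, and the class with coordinates $(\sigma_1,\dots,\sigma_6,\tau_1,\tau_2)$ is represented by $$\rho(\alpha)=E(\sigma_2,\sigma_1)T(\tau_2)E(\sigma_3,\sigma_4)T(\tau_1),\qquad \rho(\gamma)=T(\tau_1)E(\sigma_6,\sigma_5)T(\tau_2)E(\sigma_1,\sigma_2),$$ $$T(x)=x^{-1/3}\begin{pmatrix}0&0&1\\0&-1&-1\\x&1+x&1\end{pmatrix},\qquad E(z,w)=\frac{z^{1/3}}{w^{1/3}}\begin{pmatrix}0&0&1/z\\0&-1&0\\w&0&0\end{pmatrix}.$$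 Equip $\widehat{\mathfrak C}(P)$ with the Poisson structure $\{\sigma_i,\sigma_j\}=0=\{\tau_1,\tau_2\}$, $\{\sigma_i,\tau_1\}=2(-1)^{i+1}\sigma_i\tau_1$, $\{\sigma_i,\tau_2\}=-2(-1)^{i+1}\sigma_i\tau_2$; the Hamiltonian vector field $H_f$ of a smooth function $f$ is given by $dg(H_f)=\{g,f\}$ for all $g$. Let $\mathfrak U\subset\widehat{\mathfrak C}(P)$ be the unipotent locus, the set of classes for which all eigenvalues of $\rho(\alpha)$, $\rho(\beta)$ and $\rho(\gamma)$ are equal to $1$. In coordinates it is the symplectic leaf $$\mathfrak U=\{(\sigma_1,1/\sigma_1,\sigma_1,1/\sigma_1,\sigma_1,1/\sigma_1,\tau_1,1/\tau_1)\mid\sigma_1,\tau_1>0\}.$$ For $c\in\pi_1(P)$ let $\mathsf{tr}_c([\rho,A,B,C])=\mathrm{tr}(\rho(c))$. Theorem. Let $c=[\alpha,\gamma]=\alpha\gamma\alpha^{-1}\gamma^{-1}$, or $c=\alpha^k\gamma^{-1}$ with $k\ge1$ an integer. Then $\mathsf{tr}_c$ is smooth in the coordinates, and $\mathsf{tr}_c|_{\mathfrak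 U}$ attains its minimum at exactly one point. The Hamiltonian flow of $\mathsf{tr}_c|_{\mathfrak U}$ on $\mathfrak U$ exists for all times and is unique, all its orbits are periodic, and it has exactly one fixed point, which is the minimum point of $\mathsf{tr}_c|_{\mathfrak U}$. This point is $(\sigma_1,\tau_1)=\bigl(1,\tfrac{\sqrt{33}-1}{16}\bigr)$ for $c=[\alpha,\gamma]$, and $(\sigma_1,\tau_1)=\bigl(\tfrac12,1\bigr)$ for $c=\alpha^k\gamma^{-1}$, for every $k\ge1$. -/

import Mathlib

open scoped Matrix LinearAlgebra.Projectivization MatrixGroups ContDiff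

noncomputable section

namespace Pants

/-! ### The fundamental group of the pair of pants -/

/-- The group `⟨α, β, γ | α β γ = 1⟩`; the generators are the peripheral loops. -/
abbrev Pi1 : Type :=
  PresentedGroup ({FreeGroup.of 0 * FreeGroup.of 1 * FreeGroup.of 2} : Set (FreeGroup (Fin 3)))

/-- The three peripheral loops: `loop 0 = α`, `loop 1 = β`, `loop 2 = γ`. -/
def loop (i : Fin 3) : Pi1 := PresentedGroup.of i

/-- The peripheral loop `α`. -/
def α : Pi1 := loop 0

/-- The peripheral loop `β`. -/
def β : Pi1 := loop 1

/-- The peripheral loop `γ`. -/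
def γ : Pi1 := loop 2

/-! ### Flags in the real projective plane and their invariants -/

/-- The real projective plane. It is used for points (classes of column vectors) and for
projective lines (classes of linear functionals, written as vectors of coefficients). -/
abbrev P2 : Type := ℙ ℝ (Fin 3 → ℝ)

/-- A full flag `(p, ℓ)`: a point together with a projective line through it. -/
@[ext] structure FullFlag where
  /-- the point -/
  point : P2
  /-- the line, as the class of a linear functional -/
  line : P2
  /-- the point lies on the line -/
  incident : Projectivization.orthogonal line point

lemma rep_smul (g : SL(3, ℝ)) (p : P2) :
    ∃ a : ℝ, a ≠ 0 ∧ (g • p).rep = a • (g.1 *ᵥ p.rep) := by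
  have h1 : g • p.rep ≠ 0 := by
    intro h
    exact p.rep_nonzero ((smul_eq_zero_iff_eq g).1 h)
  have h2 : g • p = Projectivization.mk ℝ (g • p.rep) h1 := by
    conv_lhs => rw [← p.mk_rep]
    rw [Projectivization.smul_mk]
  obtain ⟨a, ha⟩ := Projectivization.exists_smul_eq_mk_rep ℝ (g • p.rep) h1
  refine ⟨a, a.ne_zero, ?_⟩
  rw [h2, ← ha]
  rfl

lemma dual_pairing (g : SL(3, ℝ)) (v w : Fin 3 → ℝ) :
    ((g⁻¹).transpose.1 *ᵥ v) ⬝ᵥ (g.1 *ᵥ w) = v ⬝ᵥ w := by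
  have h : (g⁻¹).1 * g.1 = 1 := by
    rw [← Matrix.SpecialLinearGroup.coe_mul, inv_mul_cancel, Matrix.SpecialLinearGroup.coe_one]
  change ((g⁻¹).1ᵀ *ᵥ v) ⬝ᵥ (g.1 *ᵥ w) = v ⬝ᵥ w
  rw [Matrix.mulVec_transpose, ← Matrix.dotProduct_mulVec, Matrix.mulVec_mulVec, h,
    Matrix.one_mulVec]

/-- The value `ℓ(p)`, for chosen representatives of the projective classes. Only expressions
that do not depend on this choice are formed from it. -/
def pairing (l p : P2) : ℝ := l.rep ⬝ᵥ p.rep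

/-- The value at `r` of the functional defining the line through `p` and `q`, for chosen
representatives. -/
def joinEval (p q r : P2) : ℝ := (crossProduct p.rep q.rep) ⬝ᵥ r.rep

lemma incident_smul (g : SL(3, ℝ)) {l p : P2} (h : Projectivization.orthogonal l p) :
    Projectivization.orthogonal ((g⁻¹).transpose • l) (g • p) := by
  have key : ∀ l p : P2, Projectivization.orthogonal l p ↔ l.rep ⬝ᵥ p.rep = 0 := by
    intro l p
    conv_lhs => rw [← l.mk_rep, ← p.mk_rep]
    exact Projectivization.orthogonal_mk _ _
  rw [key] at h ⊢
  obtain ⟨a, _, ha⟩ := rep_smul (g⁻¹).transpose l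
  obtain ⟨b, _, hb⟩ := rep_smul g p
  rw [ha, hb, smul_dotProduct, dotProduct_smul, dual_pairing, h]
  simp

/-- The action of `SL(3, ℝ) = PSL(3, ℝ)` on flags: `g · (p, ℓ) = (g p, ℓ ∘ g⁻¹)`. -/
def FullFlag.move (g : SL(3, ℝ)) (F : FullFlag) : FullFlag where
  point := g • F.point
  line := (g⁻¹).transpose • F.line
  incident := incident_smul g F.incident

/-- The first cross ratio of four flags, attached to the first flag. -/
def cr₁ (F₁ F₂ F₃ F₄ : FullFlag) : ℝ :=
  -((pairing F₁.line F₂.point * joinEval F₁.point F₃.point F₄.point) /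
    (pairing F₁.line F₄.point * joinEval F₁.point F₃.point F₂.point))

/-- The second cross ratio of four flags, attached to the third flag. -/
def cr₂ (F₁ F₂ F₃ F₄ : FullFlag) : ℝ :=
  -((pairing F₃.line F₄.point * joinEval F₁.point F₃.point F₂.point) /
    (pairing F₃.line F₂.point * joinEval F₁.point F₃.point F₄.point))

/-- The triple ratio of three flags. -/
def tripleRatio (F₁ F₂ F₃ : FullFlag) : ℝ :=
  (pairing F₁.line F₂.point * pairing F₂.line F₃.point * pairing F₃.line F₁.point) /
    (pairing F₁.line F₃.point * pairing F₂.line F₁.point * pairing F₃.line F₂.point)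

/-! ### Framed representations -/

/-- A framed representation: a representation of the fundamental group in
`SL(3, ℝ) = PSL(3, ℝ)` and, for every peripheral loop, a flag fixed by its holonomy. -/
structure FramedRep where
  /-- the holonomy representation -/
  hol : Pi1 →* SL(3, ℝ)
  /-- the framing -/
  flag : Fin 3 → FullFlag
  /-- the holonomy of a peripheral loop fixes the flag of that loop -/
  fixed : ∀ i, (flag i).move (hol (loop i)) = flag i

/-- The simultaneous action of `g` on the representation and on the framing turns `R` into `S`. -/
def Conjugates (g : SL(3, ℝ)) (R S : FramedRep) : Prop :=
  (∀ c, S.hol c = g * R.hol c * g⁻¹) ∧ ∀ i, S.flag i = (R.flag i).move g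

lemma move_mul (g h : SL(3, ℝ)) (F : FullFlag) : F.move (g * h) = (F.move h).move g := by
  have e : ((g * h)⁻¹).transpose = (g⁻¹).transpose * (h⁻¹).transpose := by
    apply Subtype.ext
    change ((g * h)⁻¹).1ᵀ = (g⁻¹).1ᵀ * (h⁻¹).1ᵀ
    rw [mul_inv_rev, Matrix.SpecialLinearGroup.coe_mul, Matrix.transpose_mul]
  ext1
  · exact mul_smul g h F.point
  · change ((g * h)⁻¹).transpose • F.line = _
    rw [e]
    exact mul_smul _ _ F.line

lemma move_one (F : FullFlag) : F.move 1 = F := by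
  have e : ((1 : SL(3, ℝ))⁻¹).transpose = 1 := by
    apply Subtype.ext
    change ((1 : SL(3, ℝ))⁻¹).1ᵀ = 1
    simp
  ext1
  · exact one_smul _ F.point
  · change ((1 : SL(3, ℝ))⁻¹).transpose • F.line = _
    rw [e]
    exact one_smul _ F.line

/-- Two framed representations are equivalent when some `g` conjugates one into the other. -/
instance FramedRep.setoid : Setoid FramedRep where
  r R S := ∃ g, Conjugates g R S
  iseqv :=
    { refl := fun R => ⟨1, by simp, fun i => (move_one _).symm⟩
      symm := by
        rintro R S ⟨g, h1, h2⟩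
        refine ⟨g⁻¹, fun c => ?_, fun i => ?_⟩
        · rw [h1]; group
        · rw [h2, ← move_mul, inv_mul_cancel, move_one]
      trans := by
        rintro R S Q ⟨g, h1, h2⟩ ⟨k, h3, h4⟩
        refine ⟨k * g, fun c => ?_, fun i => ?_⟩
        · rw [h3, h1]; group
        · rw [h4, h2, move_mul] }

/-- The moduli space of framed representations. -/
abbrev Moduli : Type := Quotient FramedRep.setoid

/-- The coordinates `(σ₁, …, σ₆, τ₁, τ₂)` of a framed representation, for the ideal triangulation
of the pair of pants by two triangles with vertices `p_α, p_β, p_γ` each. The flags of a lift of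
the first triangle are `A, B, C`, in the counterclockwise order `A, C, B`; the third vertices of
the three adjacent lifts of the second triangle carry the flags `ρ(α) B` (across the edge
between `A` and `C`), `ρ(α)⁻¹ C` (across the edge between `A` and `B`) and `ρ(γ) A` (across the
edge between `B` and `C`). -/
def FramedRep.coords (R : FramedRep) : Fin 8 → ℝ :=
  let A := R.flag 0
  let B := R.flag 1
  let C := R.flag 2
  let AC := B.move (R.hol α)
  let AB := C.move (R.hol α)⁻¹
  let BC := A.move (R.hol γ)
  ![cr₁ A AC C B, cr₂ A AC C B,
    cr₂ A C B AB, cr₁ A C B AB,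
    cr₂ B A C BC, cr₁ B A C BC,
    tripleRatio A C B, tripleRatio A AC C]

lemma cross_mulVec (g : SL(3, ℝ)) (u v w : Fin 3 → ℝ) :
    (crossProduct (g.1 *ᵥ u) (g.1 *ᵥ v)) ⬝ᵥ (g.1 *ᵥ w) = (crossProduct u v) ⬝ᵥ w := by
  have hd : g.1.det = 1 := g.2
  rw [Matrix.det_fin_three] at hd
  have : (crossProduct (g.1 *ᵥ u) (g.1 *ᵥ v)) ⬝ᵥ (g.1 *ᵥ w) =
      (g.1 0 0 * g.1 1 1 * g.1 2 2 - g.1 0 0 * g.1 1 2 * g.1 2 1 -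
        g.1 0 1 * g.1 1 0 * g.1 2 2 + g.1 0 1 * g.1 1 2 * g.1 2 0 +
        g.1 0 2 * g.1 1 0 * g.1 2 1 - g.1 0 2 * g.1 1 1 * g.1 2 0) *
        ((crossProduct u v) ⬝ᵥ w) := by
    simp [crossProduct, Matrix.mulVec, dotProduct, Fin.sum_univ_three]
    ring
  rw [this, hd, one_mul]

lemma move_scale (g : SL(3, ℝ)) : ∃ (a b : P2 → ℝ), (∀ q, a q ≠ 0) ∧ (∀ l, b l ≠ 0) ∧
    (∀ F G : FullFlag, pairing (F.move g).line (G.move g).point =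
      b F.line * a G.point * pairing F.line G.point) ∧
    (∀ F G H : FullFlag, joinEval (F.move g).point (G.move g).point (H.move g).point =
      a F.point * a G.point * a H.point * joinEval F.point G.point H.point) := by
  choose a ha ha' using rep_smul g
  choose b hb hb' using rep_smul (g⁻¹).transpose
  refine ⟨a, b, ha, hb, fun F G => ?_, fun F G H => ?_⟩
  · change ((g⁻¹).transpose • F.line).rep ⬝ᵥ (g • G.point).rep = _
    rw [ha', hb', smul_dotProduct, dotProduct_smul, dual_pairing, pairing, smul_eq_mul,
      smul_eq_mul]
    ring
  · change (crossProduct (g • F.point).rep (g • G.point).rep) ⬝ᵥ (g • H.point).rep = _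
    rw [ha', ha', ha', map_smul, map_smul, LinearMap.smul_apply, smul_dotProduct,
      smul_dotProduct, dotProduct_smul, cross_mulVec, joinEval, smul_eq_mul, smul_eq_mul,
      smul_eq_mul]
    ring

lemma cr₁_move (g : SL(3, ℝ)) (F₁ F₂ F₃ F₄ : FullFlag) :
    cr₁ (F₁.move g) (F₂.move g) (F₃.move g) (F₄.move g) = cr₁ F₁ F₂ F₃ F₄ := by
  obtain ⟨a, b, ha, hb, hp, hj⟩ := move_scale g
  unfold cr₁
  rw [hp, hp, hj, hj, ← mul_div_mul_left (pairing F₁.line F₂.point * _) _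
    (mul_ne_zero (hb F₁.line) (mul_ne_zero (ha F₂.point) (mul_ne_zero (ha F₁.point)
      (mul_ne_zero (ha F₃.point) (ha F₄.point)))))]
  congr 2 <;> ring

lemma cr₂_move (g : SL(3, ℝ)) (F₁ F₂ F₃ F₄ : FullFlag) :
    cr₂ (F₁.move g) (F₂.move g) (F₃.move g) (F₄.move g) = cr₂ F₁ F₂ F₃ F₄ := by
  obtain ⟨a, b, ha, hb, hp, hj⟩ := move_scale g
  unfold cr₂
  rw [hp, hp, hj, hj, ← mul_div_mul_left (pairing F₃.line F₄.point * _) _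
    (mul_ne_zero (hb F₃.line) (mul_ne_zero (ha F₂.point) (mul_ne_zero (ha F₁.point)
      (mul_ne_zero (ha F₃.point) (ha F₄.point)))))]
  congr 2 <;> ring

lemma tripleRatio_move (g : SL(3, ℝ)) (F₁ F₂ F₃ : FullFlag) :
    tripleRatio (F₁.move g) (F₂.move g) (F₃.move g) = tripleRatio F₁ F₂ F₃ := by
  obtain ⟨a, b, ha, hb, hp, hj⟩ := move_scale g
  unfold tripleRatio
  rw [hp, hp, hp, hp, hp, hp,
    ← mul_div_mul_left (pairing F₁.line F₂.point * pairing F₂.line F₃.point * _) _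
    (mul_ne_zero (hb F₁.line) (mul_ne_zero (hb F₂.line) (mul_ne_zero (hb F₃.line)
      (mul_ne_zero (ha F₁.point) (mul_ne_zero (ha F₂.point) (ha F₃.point))))))]
  congr 1 <;> ring

lemma coords_eq_of_conjugates {g : SL(3, ℝ)} {R S : FramedRep} (h : Conjugates g R S) :
    R.coords = S.coords := by
  obtain ⟨h1, h2⟩ := h
  have e1 : ∀ (c : Pi1) (F : FullFlag),
      (F.move g).move (g * R.hol c * g⁻¹) = (F.move (R.hol c)).move g := by
    intro c F
    rw [← move_mul, ← move_mul]
    congr 1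
    group
  have e2 : ∀ (c : Pi1) (F : FullFlag),
      (F.move g).move (g * R.hol c * g⁻¹)⁻¹ = (F.move (R.hol c)⁻¹).move g := by
    intro c F
    rw [← move_mul, ← move_mul]
    congr 1
    group
  simp only [FramedRep.coords, h1, h2, e1, e2, cr₁_move, cr₂_move, tripleRatio_move]

/-- The coordinates as functions on the moduli space. -/
def Moduli.coords : Moduli → Fin 8 → ℝ :=
  Quotient.lift FramedRep.coords (fun _ _ ⟨_, h⟩ => coords_eq_of_conjugates h)

/-- The trace function of `c` on the moduli space. -/
def Moduli.tr (c : Pi1) : Moduli → ℝ :=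
  Quotient.lift (fun R : FramedRep => (R.hol c).1.trace) (by
    rintro R S ⟨g, h, -⟩
    rw [h, Matrix.SpecialLinearGroup.coe_mul, Matrix.trace_mul_comm,
      ← Matrix.SpecialLinearGroup.coe_mul, ← mul_assoc, inv_mul_cancel, one_mul])

/-- The space of positive framed representations. With division by zero giving zero, positivity
of the coordinates includes that the flags at the vertices of adjacent triangles are in
generic position. -/
abbrev PosModuli : Type := {x : Moduli // ∀ i, 0 < x.coords i}

/-- The coordinates `(σ₁, …, σ₆, τ₁, τ₂)` on the space of positive framed representations. -/
def coords (x : PosModuli) : Fin 8 → ℝ := x.1.coords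

/-- The coordinate `σ₁`. -/
def σ₁ (x : PosModuli) : ℝ := coords x 0

/-- The coordinate `τ₁`. -/
def τ₁ (x : PosModuli) : ℝ := coords x 6

/-- The trace function of `c` on the space of positive framed representations. -/
def tr (c : Pi1) (x : PosModuli) : ℝ := x.1.tr c

/-- A matrix is unipotent if all its (complex) eigenvalues are equal to one. -/
def IsUnipotent (g : SL(3, ℝ)) : Prop := g.1.charpoly = (Polynomial.X - 1) ^ 3

/-- The unipotent locus: all peripheral holonomies are unipotent. -/
def unipotentLocus : Set PosModuli :=
  {x | ∃ R : FramedRep, (⟦R⟧ : Moduli) = x.1 ∧ ∀ i, IsUnipotent (R.hol (loop i))}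

/-! ### The matrices of the reconstruction of the holonomy from the coordinates -/

/-- The matrix for an edge of the graph that is internal to a triangle. -/
def matT (x : ℝ) : Matrix (Fin 3) (Fin 3) ℝ :=
  (1 / x ^ (1 / 3 : ℝ)) • !![0, 0, 1; 0, -1, -1; x, 1 + x, 1]

/-- The matrix for an edge of the graph that crosses an edge of the triangulation. -/
def matE (z w : ℝ) : Matrix (Fin 3) (Fin 3) ℝ :=
  (z ^ (1 / 3 : ℝ) / w ^ (1 / 3 : ℝ)) • !![0, 0, 1 / z; 0, -1, 0; w, 0, 0]

/-! ### The Poisson structure and Hamiltonian flows -/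

/-- The open orthant of points with positive coordinates. -/
def orthant : Set (Fin 8 → ℝ) := {X | ∀ i, 0 < X i}

/-- The exchange matrix of the quiver of the triangulation: number of arrows from `i` to `j`
minus number of arrows from `j` to `i`. -/
def ε : Matrix (Fin 8) (Fin 8) ℝ :=
  !![ 0,  0,  0,  0,  0,  0,  1, -1;
      0,  0,  0,  0,  0,  0, -1,  1;
      0,  0,  0,  0,  0,  0,  1, -1;
      0,  0,  0,  0,  0,  0, -1,  1;
      0,  0,  0,  0,  0,  0,  1, -1;
      0,  0,  0,  0,  0,  0, -1,  1;
     -1,  1, -1,  1, -1,  1,  0,  0;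
      1, -1,  1, -1,  1, -1,  0,  0]

/-- The Poisson bracket with `{X i, X j} = 2 ε i j X i X j`, for functions of the coordinates. -/
def poissonBracket (g f : (Fin 8 → ℝ) → ℝ) (X : Fin 8 → ℝ) : ℝ :=
  ∑ i, ∑ j, 2 * ε i j * X i * X j *
    fderiv ℝ g X (Pi.single i 1) * fderiv ℝ f X (Pi.single j 1)

/-- The components of the Hamiltonian vector field `H` of `f`, given by `dg(H) = {g, f}`. -/
def hamiltonianField (f : (Fin 8 → ℝ) → ℝ) (X : Fin 8 → ℝ) (i : Fin 8) : ℝ :=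
  poissonBracket (fun Y => Y i) f X

/-- A function on the space of positive framed representations, written in the coordinates
(and zero outside of the image of the coordinates). -/
def inCoords (f : PosModuli → ℝ) : (Fin 8 → ℝ) → ℝ := Function.extend coords f 0

/-- `Φ` is the Hamiltonian flow of `f` on the unipotent locus (a symplectic leaf): it is defined
for all times, and `t ↦ Φ t x` is the integral curve of the Hamiltonian vector field of `f`
that starts at `x`. -/
def IsHamiltonianFlow (f : PosModuli → ℝ) (Φ : ℝ → unipotentLocus → unipotentLocus) : Prop :=
  (∀ x, Φ 0 x = x) ∧
    ∀ x t i, HasDerivAt (fun s => coords (Φ s x).1 i)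
      (hamiltonianField (inCoords f) (coords (Φ t x).1) i) t

end Pants

end

open scoped Matrix LinearAlgebra.Projectivization MatrixGroups ContDiff

noncomputable section

namespace Pants

/-! Coordinates. Flags `A, C, B` in general position are determined up to `SL(3, ℝ)` by their triple
ratio, so they can be moved to `flagA`, `flagC`, `flagB` (`exists_move_eq_std`). The cross ratios
and the second triple ratio then fix the flag `ρ(α) B` and the points of `ρ(α)⁻¹ C` and `ρ(γ) A`. An
element of `SL(3, ℝ)` is known from its effect on two flags and a generic point (`eq_one_of_fixes`),
so the holonomy is determined (`hol_eq_of_coords_eq`). Conversely, `matT` rotates the standard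
triangle and `matE` crosses an edge; their products realize every positive coordinate vector
(`coords_stdRep`).

Unipotent locus. Up to conjugation each peripheral holonomy is an upper triangular product `matE *
matT * matE * matT`, so its eigenvalues are monomials up to a common scalar. Setting them equal to
one gives a monomial system whose positive solutions form the stated surface.

Dynamics. In the plane with coordinates `s = log σ₁`, `t = log τ₁` the bracket becomes `{s, t} = 2`,
because the exchange matrix has rank two and factors through the exponents of the leaf
(`hamiltonianField_leafExp`). There the trace is a constant plus a positive sum of exponentials of
linear forms, and for every direction some form is at least the norm. Such a function `F` is proper,
and monotonicity of `exp` makes it increase strictly along rays from a critical point `p`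
(`isRadial_sum_exp`). Hence `p` is the only critical point and the strict minimum.

The flow preserves `F`, whose sublevel sets are compact, so it is complete and unique. Around `p`
the angular velocity is `-2 dF(z - p) / |z - p|²`, negative and bounded away from zero on a level
set. An orbit therefore returns to its initial ray in finite time; `F` is injective on the ray, so
it returns to its initial point and is periodic (`exists_period`).

It remains to compute critical points. With `x = σ₁`, `y = τ₁`, the trace of `α ^ k * γ⁻¹` is `3 + k
(k + 1) / 2 * ((1 + x)³ / x) * ((1 + y)² / y)`, critical at `x = 1/2`, `y = 1`. The trace of the
commutator is invariant under `x ↦ 1/x`, whence `x = 1`, and its `y`-derivative there vanishes when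
`8 y² + y - 1 = 0`. -/

/-! ### Representatives of points, lines and flags -/

/-- The vector `v` represents the point `p` of the projective plane. -/
def Rep (p : P2) (v : Fin 3 → ℝ) : Prop := ∃ a : ℝ, a ≠ 0 ∧ p.rep = a • v

lemma rep_mk (v : Fin 3 → ℝ) (hv : v ≠ 0) : Rep (Projectivization.mk ℝ v hv) v := by
  obtain ⟨a, ha⟩ := Projectivization.exists_smul_eq_mk_rep ℝ v hv
  exact ⟨a, a.ne_zero, ha.symm⟩

lemma rep_self (p : P2) : Rep p p.rep := ⟨1, one_ne_zero, (one_smul _ _).symm⟩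

lemma Rep.of_smul {p : P2} {v w : Fin 3 → ℝ} {c : ℝ} (h : Rep p v) (hc : c ≠ 0)
    (e : v = c • w) : Rep p w := by
  obtain ⟨a, ha, h⟩ := h
  exact ⟨a * c, mul_ne_zero ha hc, by rw [h, e, smul_smul]⟩

lemma Rep.smul {p : P2} {v : Fin 3 → ℝ} (h : Rep p v) (g : SL(3, ℝ)) :
    Rep (g • p) (g.1 *ᵥ v) := by
  obtain ⟨a, ha, h⟩ := h
  obtain ⟨b, hb, e⟩ := rep_smul g p
  exact ⟨b * a, mul_ne_zero hb ha, by rw [e, h, Matrix.mulVec_smul, smul_smul]⟩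

lemma Rep.eq {p q : P2} {v : Fin 3 → ℝ} (hp : Rep p v) (hq : Rep q v) : p = q := by
  obtain ⟨a, ha, h⟩ := hp
  obtain ⟨b, hb, e⟩ := hq
  rw [← p.mk_rep, ← q.mk_rep]
  rw [Projectivization.mk_eq_mk_iff']
  exact ⟨a * b⁻¹, by rw [e, h, smul_smul, mul_assoc, inv_mul_cancel₀ hb, mul_one]⟩

/-- The vectors `p` and `l` represent the point and the line of the flag `F`. -/
structure FullFlag.IsRep (F : FullFlag) (p l : Fin 3 → ℝ) : Prop where
  point : Rep F.point p
  line : Rep F.line l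

lemma FullFlag.IsRep.eq {F G : FullFlag} {p l : Fin 3 → ℝ} (hF : F.IsRep p l)
    (hG : G.IsRep p l) : F = G :=
  FullFlag.ext (hF.point.eq hG.point) (hF.line.eq hG.line)

lemma FullFlag.isRep_self (F : FullFlag) : F.IsRep F.point.rep F.line.rep :=
  ⟨rep_self _, rep_self _⟩

lemma inv_transpose_mulVec (g : SL(3, ℝ)) (v : Fin 3 → ℝ) :
    (g⁻¹).transpose.1 *ᵥ (g.1ᵀ *ᵥ v) = v := by
  change (g⁻¹).1ᵀ *ᵥ (g.1ᵀ *ᵥ v) = v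
  rw [Matrix.mulVec_mulVec, ← Matrix.transpose_mul, ← Matrix.SpecialLinearGroup.coe_mul,
    mul_inv_cancel, Matrix.SpecialLinearGroup.coe_one, Matrix.transpose_one, Matrix.one_mulVec]

/-- Functionals transform by the inverse transpose. Phrasing the hypothesis on lines as `gᵀ l' = b
l` avoids computing any inverse matrix. -/
lemma FullFlag.IsRep.move {F : FullFlag} {p l p' l' : Fin 3 → ℝ} (h : F.IsRep p l)
    (g : SL(3, ℝ)) {a b : ℝ} (ha : a ≠ 0) (hb : b ≠ 0) (hp : g.1 *ᵥ p = a • p')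
    (hl : g.1ᵀ *ᵥ l' = b • l) : (F.move g).IsRep p' l' := by
  refine ⟨(h.point.smul g).of_smul ha hp, (h.line.smul (g⁻¹).transpose).of_smul
    (inv_ne_zero hb) ?_⟩
  have : l = b⁻¹ • (g.1ᵀ *ᵥ l') := by rw [hl, smul_smul, inv_mul_cancel₀ hb, one_smul]
  rw [this, Matrix.mulVec_smul, inv_transpose_mulVec]

lemma pairing_of_rep {l p : P2} {v w : Fin 3 → ℝ} {a b : ℝ} (hl : l.rep = a • v)
    (hp : p.rep = b • w) : pairing l p = a * b * (v ⬝ᵥ w) := by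
  rw [pairing, hl, hp, smul_dotProduct, dotProduct_smul, smul_eq_mul, smul_eq_mul, mul_assoc]

lemma joinEval_of_rep {p q r : P2} {u v w : Fin 3 → ℝ} {a b c : ℝ} (hp : p.rep = a • u)
    (hq : q.rep = b • v) (hr : r.rep = c • w) :
    joinEval p q r = a * b * c * (crossProduct u v ⬝ᵥ w) := by
  rw [joinEval, hp, hq, hr, map_smul, map_smul, LinearMap.smul_apply, smul_dotProduct,
    smul_dotProduct, dotProduct_smul]
  simp only [smul_eq_mul]
  ring

/-- Each scalar relating two representatives enters numerator and denominator equally often. Only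
the common nonzero factor is cancelled, so degenerate denominators need no exclusion. -/
lemma cr₁_of_isRep {F₁ F₂ F₃ F₄ : FullFlag} {p₁ p₂ p₃ p₄ l₁ l₂ l₃ l₄ : Fin 3 → ℝ}
    (h₁ : F₁.IsRep p₁ l₁) (h₂ : F₂.IsRep p₂ l₂) (h₃ : F₃.IsRep p₃ l₃) (h₄ : F₄.IsRep p₄ l₄) :
    cr₁ F₁ F₂ F₃ F₄ = -((l₁ ⬝ᵥ p₂ * (crossProduct p₁ p₃ ⬝ᵥ p₄)) /
      (l₁ ⬝ᵥ p₄ * (crossProduct p₁ p₃ ⬝ᵥ p₂))) := by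
  obtain ⟨⟨a₁, ha₁, e₁⟩, ⟨b₁, hb₁, f₁⟩⟩ := h₁
  obtain ⟨⟨a₂, ha₂, e₂⟩, -⟩ := h₂
  obtain ⟨⟨a₃, ha₃, e₃⟩, -⟩ := h₃
  obtain ⟨⟨a₄, ha₄, e₄⟩, -⟩ := h₄
  rw [cr₁, pairing_of_rep f₁ e₂, pairing_of_rep f₁ e₄, joinEval_of_rep e₁ e₃ e₄,
    joinEval_of_rep e₁ e₃ e₂, ← mul_div_mul_left (l₁ ⬝ᵥ p₂ * _) _
    (mul_ne_zero hb₁ (mul_ne_zero ha₂ (mul_ne_zero ha₁ (mul_ne_zero ha₃ ha₄))))]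
  congr 2 <;> ring

lemma cr₂_of_isRep {F₁ F₂ F₃ F₄ : FullFlag} {p₁ p₂ p₃ p₄ l₁ l₂ l₃ l₄ : Fin 3 → ℝ}
    (h₁ : F₁.IsRep p₁ l₁) (h₂ : F₂.IsRep p₂ l₂) (h₃ : F₃.IsRep p₃ l₃) (h₄ : F₄.IsRep p₄ l₄) :
    cr₂ F₁ F₂ F₃ F₄ = -((l₃ ⬝ᵥ p₄ * (crossProduct p₁ p₃ ⬝ᵥ p₂)) /
      (l₃ ⬝ᵥ p₂ * (crossProduct p₁ p₃ ⬝ᵥ p₄))) := by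
  obtain ⟨⟨a₁, ha₁, e₁⟩, -⟩ := h₁
  obtain ⟨⟨a₂, ha₂, e₂⟩, -⟩ := h₂
  obtain ⟨⟨a₃, ha₃, e₃⟩, ⟨b₃, hb₃, f₃⟩⟩ := h₃
  obtain ⟨⟨a₄, ha₄, e₄⟩, -⟩ := h₄
  rw [cr₂, pairing_of_rep f₃ e₂, pairing_of_rep f₃ e₄, joinEval_of_rep e₁ e₃ e₄,
    joinEval_of_rep e₁ e₃ e₂, ← mul_div_mul_left (l₃ ⬝ᵥ p₄ * _) _
    (mul_ne_zero hb₃ (mul_ne_zero ha₂ (mul_ne_zero ha₁ (mul_ne_zero ha₃ ha₄))))]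
  congr 2 <;> ring

lemma tripleRatio_of_isRep {F₁ F₂ F₃ : FullFlag} {p₁ p₂ p₃ l₁ l₂ l₃ : Fin 3 → ℝ}
    (h₁ : F₁.IsRep p₁ l₁) (h₂ : F₂.IsRep p₂ l₂) (h₃ : F₃.IsRep p₃ l₃) :
    tripleRatio F₁ F₂ F₃ = (l₁ ⬝ᵥ p₂ * (l₂ ⬝ᵥ p₃) * (l₃ ⬝ᵥ p₁)) /
      (l₁ ⬝ᵥ p₃ * (l₂ ⬝ᵥ p₁) * (l₃ ⬝ᵥ p₂)) := by
  obtain ⟨⟨a₁, ha₁, e₁⟩, ⟨b₁, hb₁, f₁⟩⟩ := h₁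
  obtain ⟨⟨a₂, ha₂, e₂⟩, ⟨b₂, hb₂, f₂⟩⟩ := h₂
  obtain ⟨⟨a₃, ha₃, e₃⟩, ⟨b₃, hb₃, f₃⟩⟩ := h₃
  rw [tripleRatio, pairing_of_rep f₁ e₂, pairing_of_rep f₂ e₃, pairing_of_rep f₃ e₁,
    pairing_of_rep f₁ e₃, pairing_of_rep f₂ e₁, pairing_of_rep f₃ e₂,
    ← mul_div_mul_left (l₁ ⬝ᵥ p₂ * (l₂ ⬝ᵥ p₃) * _) _
    (mul_ne_zero hb₁ (mul_ne_zero hb₂ (mul_ne_zero hb₃ (mul_ne_zero ha₁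
      (mul_ne_zero ha₂ ha₃)))))]
  congr 1 <;> ring

/-! ### Flags determined by their invariants -/

lemma pairing_self (F : FullFlag) : pairing F.line F.point = 0 := by
  have h := F.incident
  rw [← F.line.mk_rep, ← F.point.mk_rep] at h
  exact (Projectivization.orthogonal_mk F.line.rep_nonzero F.point.rep_nonzero).1 h

lemma FullFlag.IsRep.incident {F : FullFlag} {p l : Fin 3 → ℝ} (h : F.IsRep p l) :
    l ⬝ᵥ p = 0 := by
  obtain ⟨⟨a, ha, e⟩, ⟨b, hb, f⟩⟩ := h
  have := pairing_self F
  rw [pairing_of_rep f e] at this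
  exact (mul_eq_zero.1 this).resolve_left (mul_ne_zero hb ha)

lemma eq_zero_of_dotProduct {u v w x : Fin 3 → ℝ} (h : crossProduct u v ⬝ᵥ w ≠ 0)
    (hu : u ⬝ᵥ x = 0) (hv : v ⬝ᵥ x = 0) (hw : w ⬝ᵥ x = 0) : x = 0 := by
  refine Matrix.eq_zero_of_mulVec_eq_zero (M := Matrix.of ![u, v, w]) ?_ ?_
  · rw [Matrix.det_fin_three]
    intro h0
    apply h
    rw [← h0]
    simp [crossProduct, dotProduct, Fin.sum_univ_three]
    ring
  · ext i
    fin_cases i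
    · exact hu
    · exact hv
    · exact hw

lemma rep_of_smul_eq {p q : P2} {a b : ℝ} (ha : a ≠ 0) (hb : b ≠ 0)
    (h : a • p.rep = b • q.rep) : p = q := by
  refine (rep_self p).eq ((rep_self q).of_smul (c := b⁻¹ * a) (mul_ne_zero (inv_ne_zero hb) ha) ?_)
  rw [mul_smul, h, smul_smul, inv_mul_cancel₀ hb, one_smul]

/-- The lines of `F` and `G` and the line joining their points are three independent functionals, so
a point is determined by the ratios of its three values. -/
lemma point_eq_of_pairing {F G : FullFlag} {q r : P2} (hFG : pairing F.line G.point ≠ 0)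
    (hGF : pairing G.line F.point ≠ 0) (hq : joinEval F.point G.point q ≠ 0)
    (hr : joinEval F.point G.point r ≠ 0)
    (h₁ : pairing F.line q * joinEval F.point G.point r =
      pairing F.line r * joinEval F.point G.point q)
    (h₂ : pairing G.line q * joinEval F.point G.point r =
      pairing G.line r * joinEval F.point G.point q) : q = r := by
  refine rep_of_smul_eq hr hq (sub_eq_zero.1 (eq_zero_of_dotProduct (u := F.line.rep)
    (v := G.line.rep) (w := crossProduct F.point.rep G.point.rep) ?_ ?_ ?_ ?_))
  -- Independence: by the Binet–Cauchy identity the triple product of the functionals is a 2×2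
  -- determinant, whose diagonal term vanishes by incidence.
  · have e : crossProduct F.line.rep G.line.rep ⬝ᵥ crossProduct F.point.rep G.point.rep =
        pairing F.line F.point * pairing G.line G.point -
          pairing F.line G.point * pairing G.line F.point := by
      simp [crossProduct, dotProduct, Fin.sum_univ_three, pairing]
      ring
    rw [e, pairing_self, zero_mul, zero_sub]
    exact neg_ne_zero.2 (mul_ne_zero hFG hGF)
  · simp only [pairing] at h₁
    rw [dotProduct_sub, dotProduct_smul, dotProduct_smul, smul_eq_mul, smul_eq_mul]
    linarith
  · simp only [pairing] at h₂
    rw [dotProduct_sub, dotProduct_smul, dotProduct_smul, smul_eq_mul, smul_eq_mul]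
    linarith
  · rw [dotProduct_sub, dotProduct_smul, dotProduct_smul, smul_eq_mul, smul_eq_mul]
    simp only [joinEval]
    ring

/-- Since division by zero gives zero, a nonzero invariant carries the general position of the flags
entering it. This is how positivity of the coordinates is exploited. -/
lemma cr₁_ne_zero {F₁ F₂ F₃ F₄ : FullFlag} (h : cr₁ F₁ F₂ F₃ F₄ ≠ 0) :
    pairing F₁.line F₂.point ≠ 0 ∧ pairing F₁.line F₄.point ≠ 0 ∧
      joinEval F₁.point F₃.point F₂.point ≠ 0 ∧ joinEval F₁.point F₃.point F₄.point ≠ 0 := by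
  simp only [cr₁, ne_eq, neg_eq_zero, div_eq_zero_iff, mul_eq_zero] at h
  tauto

lemma cr₂_ne_zero {F₁ F₂ F₃ F₄ : FullFlag} (h : cr₂ F₁ F₂ F₃ F₄ ≠ 0) :
    pairing F₃.line F₂.point ≠ 0 ∧ pairing F₃.line F₄.point ≠ 0 ∧
      joinEval F₁.point F₃.point F₂.point ≠ 0 ∧ joinEval F₁.point F₃.point F₄.point ≠ 0 := by
  simp only [cr₂, ne_eq, neg_eq_zero, div_eq_zero_iff, mul_eq_zero] at h
  tauto

lemma tripleRatio_ne_zero {F₁ F₂ F₃ : FullFlag} (h : tripleRatio F₁ F₂ F₃ ≠ 0) :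
    (pairing F₁.line F₂.point ≠ 0 ∧ pairing F₁.line F₃.point ≠ 0) ∧
      (pairing F₂.line F₁.point ≠ 0 ∧ pairing F₂.line F₃.point ≠ 0) ∧
      pairing F₃.line F₁.point ≠ 0 ∧ pairing F₃.line F₂.point ≠ 0 := by
  simp only [tripleRatio, ne_eq, div_eq_zero_iff, mul_eq_zero] at h
  tauto

/-- The point of the fourth flag is determined by the cross ratios. -/
lemma fourth_point_eq {F₁ F₂ F₃ F G : FullFlag} (h13 : pairing F₁.line F₃.point ≠ 0)
    (h31 : pairing F₃.line F₁.point ≠ 0) (n₁ : cr₁ F₁ F₂ F₃ F ≠ 0) (n₂ : cr₂ F₁ F₂ F₃ F ≠ 0)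
    (e₁ : cr₁ F₁ F₂ F₃ F = cr₁ F₁ F₂ F₃ G) (e₂ : cr₂ F₁ F₂ F₃ F = cr₂ F₁ F₂ F₃ G) :
    F.point = G.point := by
  obtain ⟨a1, a2, a3, a4⟩ := cr₁_ne_zero n₁
  obtain ⟨b1, b2, -, -⟩ := cr₂_ne_zero n₂
  obtain ⟨-, c2, -, c4⟩ := cr₁_ne_zero (e₁ ▸ n₁)
  obtain ⟨-, d2, -, -⟩ := cr₂_ne_zero (e₂ ▸ n₂)
  refine point_eq_of_pairing h13 h31 a4 c4 ?_ ?_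
  · simp only [cr₁] at e₁
    field_simp at e₁
    linear_combination e₁
  · simp only [cr₂] at e₂
    field_simp at e₂
    linear_combination -e₂

/-- The point of the second flag is determined by the cross ratios. -/
lemma second_point_eq {F₁ F₃ F₄ F G : FullFlag} (h13 : pairing F₁.line F₃.point ≠ 0)
    (h31 : pairing F₃.line F₁.point ≠ 0) (n₁ : cr₁ F₁ F F₃ F₄ ≠ 0) (n₂ : cr₂ F₁ F F₃ F₄ ≠ 0)
    (e₁ : cr₁ F₁ F F₃ F₄ = cr₁ F₁ G F₃ F₄) (e₂ : cr₂ F₁ F F₃ F₄ = cr₂ F₁ G F₃ F₄) :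
    F.point = G.point := by
  obtain ⟨a1, a2, a3, a4⟩ := cr₁_ne_zero n₁
  obtain ⟨b1, b2, -, -⟩ := cr₂_ne_zero n₂
  obtain ⟨c1, -, c3, -⟩ := cr₁_ne_zero (e₁ ▸ n₁)
  obtain ⟨d1, -, -, -⟩ := cr₂_ne_zero (e₂ ▸ n₂)
  refine point_eq_of_pairing h13 h31 a3 c3 ?_ ?_
  · simp only [cr₁] at e₁
    field_simp at e₁
    linear_combination -e₁
  · simp only [cr₂] at e₂
    field_simp at e₂
    linear_combination e₂

/-- A flag is determined by its point and a triple ratio. -/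
lemma flag_eq_of_tripleRatio {F₁ F₃ F G : FullFlag} (hp : F.point = G.point)
    (hj : joinEval F₁.point F₃.point F.point ≠ 0) (n : tripleRatio F₁ F F₃ ≠ 0)
    (e : tripleRatio F₁ F F₃ = tripleRatio F₁ G F₃) : F = G := by
  obtain ⟨⟨a1, a2⟩, ⟨a3, a4⟩, a5, a6⟩ := tripleRatio_ne_zero n
  obtain ⟨⟨b1, b2⟩, ⟨b3, b4⟩, b5, b6⟩ := tripleRatio_ne_zero (e ▸ n)
  have hF := pairing_self F
  have hG := pairing_self G
  -- A combination of the two lines chosen to vanish at `F₁.point` also vanishes at `F₃.point`, by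
  -- equality of triple ratios, and at the common point, by incidence; these three points span.
  refine FullFlag.ext hp (rep_of_smul_eq b3 a3 (sub_eq_zero.1
    (eq_zero_of_dotProduct (u := F₁.point.rep) (v := F₃.point.rep) (w := F.point.rep) hj
      ?_ ?_ ?_)))
  · rw [dotProduct_comm, sub_dotProduct, smul_dotProduct, smul_dotProduct, smul_eq_mul,
      smul_eq_mul]
    simp only [pairing]
    ring
  · rw [dotProduct_comm, sub_dotProduct, smul_dotProduct, smul_dotProduct, smul_eq_mul,
      smul_eq_mul]
    simp only [tripleRatio] at e
    rw [← hp] at e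
    field_simp at e
    simp only [pairing] at e ⊢
    linear_combination e
  · rw [← hp] at hG
    rw [dotProduct_comm, sub_dotProduct, smul_dotProduct, smul_dotProduct, smul_eq_mul,
      smul_eq_mul]
    simp only [pairing] at hF hG ⊢
    rw [hF, hG]
    ring

/-! ### Rigidity -/

lemma mulVec_rep_of_smul_eq {k : SL(3, ℝ)} {p : P2} (h : k • p = p) :
    ∃ a : ℝ, k.1 *ᵥ p.rep = a • p.rep := by
  obtain ⟨a, ha, e⟩ := rep_smul k p
  rw [h] at e
  refine ⟨a⁻¹, ?_⟩
  conv_rhs => rw [e, smul_smul, inv_mul_cancel₀ ha, one_smul]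

lemma transpose_mulVec_rep {k : SL(3, ℝ)} {l : P2} (h : (k⁻¹).transpose • l = l) :
    ∃ b : ℝ, k.1ᵀ *ᵥ l.rep = b • l.rep := by
  apply mulVec_rep_of_smul_eq (k := k.transpose)
  have e : k.transpose * (k⁻¹).transpose = 1 := by
    apply Subtype.ext
    change k.1ᵀ * (k⁻¹).1ᵀ = 1
    rw [← Matrix.transpose_mul, ← Matrix.SpecialLinearGroup.coe_mul, inv_mul_cancel]
    simp
  conv_lhs => rw [← h]
  rw [smul_smul, e, one_smul]

/-- Evaluate `l ⬝ᵥ M p` in two ways. -/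
lemma eigenvalue_of_dotProduct {M : Matrix (Fin 3) (Fin 3) ℝ} {l p : Fin 3 → ℝ} {a b : ℝ}
    (hp : M *ᵥ p = a • p) (hl : Mᵀ *ᵥ l = b • l) (h : l ⬝ᵥ p ≠ 0) : a = b := by
  have : l ⬝ᵥ (M *ᵥ p) = (Mᵀ *ᵥ l) ⬝ᵥ p := by
    rw [Matrix.mulVec_transpose, Matrix.dotProduct_mulVec]
  rw [hp, hl, dotProduct_smul, smul_dotProduct, smul_eq_mul, smul_eq_mul] at this
  exact mul_right_cancel₀ h this

/-- An element of `SL(3, ℝ)` that fixes two flags and a point in general position is trivial. -/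
lemma eq_one_of_fixes {k : SL(3, ℝ)} {F G : FullFlag} {r : P2} (hF : F.move k = F)
    (hG : G.move k = G) (hr : k • r = r) (hFG : pairing F.line G.point ≠ 0)
    (hGF : pairing G.line F.point ≠ 0) (hFr : pairing F.line r ≠ 0)
    (hGr : pairing G.line r ≠ 0) (hj : joinEval F.point G.point r ≠ 0) : k = 1 := by
  obtain ⟨a, ha⟩ := mulVec_rep_of_smul_eq (k := k) (p := F.point)
    (congrArg FullFlag.point hF)
  obtain ⟨b, hb⟩ := mulVec_rep_of_smul_eq (k := k) (p := G.point)
    (congrArg FullFlag.point hG)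
  obtain ⟨c, hc⟩ := mulVec_rep_of_smul_eq hr
  obtain ⟨d, hd⟩ := transpose_mulVec_rep (k := k) (l := F.line) (congrArg FullFlag.line hF)
  obtain ⟨e, he⟩ := transpose_mulVec_rep (k := k) (l := G.line) (congrArg FullFlag.line hG)
  -- Each line is nonzero at `r` and at the point of the other flag, which forces the eigenvalues at
  -- all three points to agree.
  have h1 := eigenvalue_of_dotProduct hb hd hFG
  have h2 := eigenvalue_of_dotProduct hc hd hFr
  have h3 := eigenvalue_of_dotProduct ha he hGF
  have h4 := eigenvalue_of_dotProduct hc he hGr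
  have hac : a = c := h3.trans h4.symm
  have hbc : b = c := h1.trans h2.symm
  subst hac hbc
  have hk : k.1 = b • (1 : Matrix (Fin 3) (Fin 3) ℝ) := by
    have row : ∀ i, (k.1 - b • (1 : Matrix (Fin 3) (Fin 3) ℝ)) i = 0 := by
      intro i
      have key : ∀ v : Fin 3 → ℝ, k.1 *ᵥ v = b • v →
          v ⬝ᵥ (k.1 - b • (1 : Matrix (Fin 3) (Fin 3) ℝ)) i = 0 := by
        intro v hv
        have : ((k.1 - b • (1 : Matrix (Fin 3) (Fin 3) ℝ)) *ᵥ v) i = 0 := by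
          rw [Matrix.sub_mulVec, hv, Matrix.smul_mulVec, Matrix.one_mulVec, sub_self]
          rfl
        rw [dotProduct_comm]
        exact this
      exact eq_zero_of_dotProduct hj (key _ ha) (key _ hb) (key _ hc)
    exact sub_eq_zero.1 (funext row)
  have hdet : b ^ 3 = 1 := by
    have := k.2
    rw [hk, Matrix.det_smul, Matrix.det_one, mul_one] at this
    simpa using this
  have hb1 : b = 1 := by
    have h0 : (b - 1) * (b ^ 2 + b + 1) = 0 := by linear_combination hdet
    rcases mul_eq_zero.1 h0 with h | h
    · linarith
    · nlinarith [sq_nonneg (b + 1 / 2)]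
  apply Subtype.ext
  rw [hk, hb1, one_smul]
  rfl

/-! ### The standard flags and the elementary matrices -/

lemma cbrt_pow {x : ℝ} (hx : 0 < x) : (x ^ (1 / 3 : ℝ)) ^ 3 = x := by
  rw [← Real.rpow_natCast, ← Real.rpow_mul hx.le]
  norm_num

lemma det_matT {x : ℝ} (hx : 0 < x) : (matT x).det = 1 := by
  have h := cbrt_pow hx
  have h0 : x ^ (1 / 3 : ℝ) ≠ 0 := (Real.rpow_pos_of_pos hx _).ne'
  rw [matT, Matrix.det_smul, Matrix.det_fin_three]
  simp [-one_div]
  rw [div_pow, h]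
  field_simp

lemma det_matE {z w : ℝ} (hz : 0 < z) (hw : 0 < w) : (matE z w).det = 1 := by
  have h0 : w ^ (1 / 3 : ℝ) ≠ 0 := (Real.rpow_pos_of_pos hw _).ne'
  rw [matE, Matrix.det_smul, Matrix.det_fin_three]
  simp [-one_div]
  rw [div_pow, cbrt_pow hz, cbrt_pow hw]
  field_simp

/-- The matrix `matT x` as an element of `SL(3, ℝ)`. -/
def slT (x : ℝ) (hx : 0 < x) : SL(3, ℝ) := ⟨matT x, det_matT hx⟩

/-- The matrix `matE z w` as an element of `SL(3, ℝ)`. -/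
def slE (z w : ℝ) (hz : 0 < z) (hw : 0 < w) : SL(3, ℝ) := ⟨matE z w, det_matE hz hw⟩

/-- The flag with given representatives. -/
def mkFlag (p l : Fin 3 → ℝ) (hp : p ≠ 0) (hl : l ≠ 0) (h : l ⬝ᵥ p = 0) : FullFlag where
  point := Projectivization.mk ℝ p hp
  line := Projectivization.mk ℝ l hl
  incident := (Projectivization.orthogonal_mk hl hp).2 h

lemma isRep_mkFlag (p l : Fin 3 → ℝ) (hp : p ≠ 0) (hl : l ≠ 0) (h : l ⬝ᵥ p = 0) :
    (mkFlag p l hp hl h).IsRep p l :=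
  ⟨rep_mk p hp, rep_mk l hl⟩

/-- The standard flag at the end of `α`. -/
def flagA : FullFlag := mkFlag ![1, 0, 0] ![0, 0, 1]
  (fun h => by simpa using congrFun h 0) (fun h => by simpa using congrFun h 2)
  (by simp [dotProduct, Fin.sum_univ_three])

/-- The standard flag at the end of `γ`. -/
def flagC : FullFlag := mkFlag ![0, 0, 1] ![1, 0, 0]
  (fun h => by simpa using congrFun h 2) (fun h => by simpa using congrFun h 0)
  (by simp [dotProduct, Fin.sum_univ_three])

/-- The flag that has triple ratio `x` with `flagA` and `flagC`. -/
def flagB (x : ℝ) : FullFlag := mkFlag ![1, -1, 1] ![x, 1 + x, 1]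
  (fun h => by simpa using congrFun h 0) (fun h => by simpa using congrFun h 2)
  (by simp [dotProduct, Fin.sum_univ_three])

lemma isRep_flagA : flagA.IsRep ![1, 0, 0] ![0, 0, 1] := isRep_mkFlag _ _ _ _ _

lemma isRep_flagC : flagC.IsRep ![0, 0, 1] ![1, 0, 0] := isRep_mkFlag _ _ _ _ _

lemma isRep_flagB (x : ℝ) : (flagB x).IsRep ![1, -1, 1] ![x, 1 + x, 1] := isRep_mkFlag _ _ _ _ _

lemma matT_mulVec (x : ℝ) (v : Fin 3 → ℝ) : matT x *ᵥ v =
    (1 / x ^ (1 / 3 : ℝ)) • ![v 2, -v 1 - v 2, x * v 0 + (1 + x) * v 1 + v 2] := by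
  rw [matT, Matrix.smul_mulVec]
  congr 1
  ext i
  fin_cases i <;> (simp [Matrix.mulVec, dotProduct, Fin.sum_univ_three]; try ring)

lemma matT_transpose_mulVec (x : ℝ) (v : Fin 3 → ℝ) : (matT x)ᵀ *ᵥ v =
    (1 / x ^ (1 / 3 : ℝ)) • ![x * v 2, -v 1 + (1 + x) * v 2, v 0 - v 1 + v 2] := by
  rw [matT, Matrix.transpose_smul, Matrix.smul_mulVec]
  congr 1
  ext i
  fin_cases i <;> (simp [Matrix.mulVec, dotProduct, Fin.sum_univ_three]; try ring)

lemma matE_mulVec (z w : ℝ) (v : Fin 3 → ℝ) : matE z w *ᵥ v =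
    (z ^ (1 / 3 : ℝ) / w ^ (1 / 3 : ℝ)) • ![1 / z * v 2, -v 1, w * v 0] := by
  rw [matE, Matrix.smul_mulVec]
  congr 1
  ext i
  fin_cases i <;> simp [Matrix.mulVec, dotProduct, Fin.sum_univ_three]

lemma matE_transpose_mulVec (z w : ℝ) (v : Fin 3 → ℝ) : (matE z w)ᵀ *ᵥ v =
    (z ^ (1 / 3 : ℝ) / w ^ (1 / 3 : ℝ)) • ![w * v 2, -v 1, 1 / z * v 0] := by
  rw [matE, Matrix.transpose_smul, Matrix.smul_mulVec]
  congr 1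
  ext i
  fin_cases i <;> simp [Matrix.mulVec, dotProduct, Fin.sum_univ_three]

lemma scaleT_ne {x : ℝ} (hx : 0 < x) : 1 / x ^ (1 / 3 : ℝ) ≠ 0 :=
  one_div_ne_zero (Real.rpow_pos_of_pos hx _).ne'

lemma scaleE_ne {z w : ℝ} (hz : 0 < z) (hw : 0 < w) : z ^ (1 / 3 : ℝ) / w ^ (1 / 3 : ℝ) ≠ 0 :=
  div_ne_zero (Real.rpow_pos_of_pos hz _).ne' (Real.rpow_pos_of_pos hw _).ne'

/-- With the next two lemmas: `slT x` rotates the standard triangle, `A → C → B → A`. -/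
lemma flagA_move_slT {x : ℝ} (hx : 0 < x) : flagA.move (slT x hx) = flagC := by
  refine (isRep_flagA.move _ (mul_ne_zero (scaleT_ne hx) hx.ne') (scaleT_ne hx) ?_ ?_).eq
    isRep_flagC
  · change matT x *ᵥ _ = _
    rw [matT_mulVec, mul_smul]
    congr 1
    ext i
    fin_cases i <;> simp
  · change (matT x)ᵀ *ᵥ _ = _
    rw [matT_transpose_mulVec]
    congr 1
    ext i
    fin_cases i <;> simp

lemma flagC_move_slT {x : ℝ} (hx : 0 < x) : flagC.move (slT x hx) = flagB x := by
  refine (isRep_flagC.move _ (scaleT_ne hx) (mul_ne_zero (scaleT_ne hx) hx.ne') ?_ ?_).eq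
    (isRep_flagB x)
  · change matT x *ᵥ _ = _
    rw [matT_mulVec]
    congr 1
    ext i
    fin_cases i <;> simp
  · change (matT x)ᵀ *ᵥ _ = _
    rw [matT_transpose_mulVec, mul_smul]
    congr 1
    ext i
    fin_cases i <;> simp

lemma flagB_move_slT {x : ℝ} (hx : 0 < x) : (flagB x).move (slT x hx) = flagA := by
  refine ((isRep_flagB x).move _ (scaleT_ne hx) (scaleT_ne hx) ?_ ?_).eq isRep_flagA
  · change matT x *ᵥ _ = _
    rw [matT_mulVec]
    congr 1
    ext i
    fin_cases i <;> simp
  · change (matT x)ᵀ *ᵥ _ = _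
    rw [matT_transpose_mulVec]
    congr 1
    ext i
    fin_cases i <;> simp

/-- Crossing the edge `AC`: `slE` exchanges its ends and carries `B` to the third vertex of the
neighbouring triangle. -/
lemma flagA_move_slE {z w : ℝ} (hz : 0 < z) (hw : 0 < w) :
    flagA.move (slE z w hz hw) = flagC := by
  refine (isRep_flagA.move _ (mul_ne_zero (scaleE_ne hz hw) hw.ne')
    (mul_ne_zero (scaleE_ne hz hw) (one_div_ne_zero hz.ne')) ?_ ?_).eq isRep_flagC
  · change matE z w *ᵥ _ = _
    rw [matE_mulVec, mul_smul]
    congr 1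
    ext i
    fin_cases i <;> simp
  · change (matE z w)ᵀ *ᵥ _ = _
    rw [matE_transpose_mulVec, mul_smul]
    congr 1
    ext i
    fin_cases i <;> simp

lemma slE_mul_slE {z w : ℝ} (hz : 0 < z) (hw : 0 < w) :
    slE z w hz hw * slE w z hw hz = 1 := by
  have h1 : z ^ (1 / 3 : ℝ) ≠ 0 := (Real.rpow_pos_of_pos hz _).ne'
  have h2 : w ^ (1 / 3 : ℝ) ≠ 0 := (Real.rpow_pos_of_pos hw _).ne'
  have hzz := hz.ne'
  have hww := hw.ne'
  apply Subtype.ext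
  change matE z w * matE w z = 1
  rw [matE, matE, smul_mul_smul_comm]
  have : z ^ (1 / 3 : ℝ) / w ^ (1 / 3 : ℝ) * (w ^ (1 / 3 : ℝ) / z ^ (1 / 3 : ℝ)) = 1 := by
    field_simp
  rw [this, one_smul]
  ext i j
  fin_cases i <;> fin_cases j <;> simp [Matrix.mul_apply, Fin.sum_univ_three, hzz, hww]

lemma slE_inv {z w : ℝ} (hz : 0 < z) (hw : 0 < w) :
    (slE z w hz hw)⁻¹ = slE w z hw hz :=
  inv_eq_of_mul_eq_one_right (slE_mul_slE hz hw)

lemma flagC_move_slE {z w : ℝ} (hz : 0 < z) (hw : 0 < w) :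
    flagC.move (slE z w hz hw) = flagA := by
  rw [← flagA_move_slE hw hz, ← move_mul, slE_mul_slE, move_one]

lemma isRep_flagB_move_slE {z w x : ℝ} (hz : 0 < z) (hw : 0 < w) :
    ((flagB x).move (slE z w hz hw)).IsRep ![1 / z, 1, w] ![z, -(1 + x), x / w] := by
  have hzz := hz.ne'
  have hww := hw.ne'
  refine (isRep_flagB x).move _ (scaleE_ne hz hw) (scaleE_ne hz hw) ?_ ?_
  · change matE z w *ᵥ _ = _
    rw [matE_mulVec]
    congr 1
    ext i
    fin_cases i <;> simp
  · change (matE z w)ᵀ *ᵥ _ = _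
    rw [matE_transpose_mulVec]
    congr 1
    ext i
    fin_cases i <;> simp [hzz]
    field_simp

lemma move_inv_of_eq {F G : FullFlag} {g : SL(3, ℝ)} (h : F.move g = G) : G.move g⁻¹ = F := by
  rw [← h, ← move_mul, inv_mul_cancel, move_one]

/-! ### The invariants of the standard flags -/

lemma tripleRatio_std (x : ℝ) : tripleRatio flagA flagC (flagB x) = x := by
  rw [tripleRatio_of_isRep isRep_flagA isRep_flagC (isRep_flagB x)]
  simp [dotProduct, Fin.sum_univ_three]

/-- Only the points of the second and fourth flags enter a cross ratio, so the triple ratios `x` and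
`y` drop out. -/
lemma cr₁_first {x y z w : ℝ} (hz : 0 < z) (hw : 0 < w) :
    cr₁ flagA ((flagB y).move (slE z w hz hw)) flagC (flagB x) = w := by
  rw [cr₁_of_isRep isRep_flagA (isRep_flagB_move_slE hz hw) isRep_flagC (isRep_flagB x)]
  simp [dotProduct, crossProduct, Fin.sum_univ_three, div_neg]

lemma cr₂_first {x y z w : ℝ} (hz : 0 < z) (hw : 0 < w) :
    cr₂ flagA ((flagB y).move (slE z w hz hw)) flagC (flagB x) = z := by
  rw [cr₂_of_isRep isRep_flagA (isRep_flagB_move_slE hz hw) isRep_flagC (isRep_flagB x)]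
  simp [dotProduct, crossProduct, Fin.sum_univ_three]

lemma tripleRatio_adjacent {y z w : ℝ} (hz : 0 < z) (hw : 0 < w) :
    tripleRatio flagA ((flagB y).move (slE z w hz hw)) flagC = y := by
  have hzz := hz.ne'
  have hww := hw.ne'
  rw [tripleRatio_of_isRep isRep_flagA (isRep_flagB_move_slE hz hw) isRep_flagC]
  simp [dotProduct, Fin.sum_univ_three]
  field_simp

/-- The same edge read from its other end. The edges `AB` and `BC` are reduced to this configuration
by a rotation. -/
lemma cr₁_adjacent {x y z w : ℝ} (hz : 0 < z) (hw : 0 < w) :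
    cr₁ flagC (flagB x) flagA ((flagB y).move (slE z w hz hw)) = z := by
  rw [cr₁_of_isRep isRep_flagC (isRep_flagB x) isRep_flagA (isRep_flagB_move_slE hz hw)]
  simp [dotProduct, crossProduct, Fin.sum_univ_three]

lemma cr₂_adjacent {x y z w : ℝ} (hz : 0 < z) (hw : 0 < w) :
    cr₂ flagC (flagB x) flagA ((flagB y).move (slE z w hz hw)) = w := by
  rw [cr₂_of_isRep isRep_flagC (isRep_flagB x) isRep_flagA (isRep_flagB_move_slE hz hw)]
  simp [dotProduct, crossProduct, Fin.sum_univ_three]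

/-! ### The standard framed representation with given coordinates -/

variable {X : Fin 8 → ℝ}

/-- The holonomy of `α` in terms of the coordinates. -/
def holA (hX : ∀ i, 0 < X i) : SL(3, ℝ) :=
  slE (X 1) (X 0) (hX 1) (hX 0) * slT (X 7) (hX 7) * slE (X 2) (X 3) (hX 2) (hX 3) *
    slT (X 6) (hX 6)

/-- The holonomy of `γ` in terms of the coordinates. -/
def holC (hX : ∀ i, 0 < X i) : SL(3, ℝ) :=
  slT (X 6) (hX 6) * slE (X 5) (X 4) (hX 5) (hX 4) * slT (X 7) (hX 7) *
    slE (X 0) (X 1) (hX 0) (hX 1)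

lemma flagA_move_holA (hX : ∀ i, 0 < X i) : flagA.move (holA hX) = flagA := by
  rw [holA, move_mul, move_mul, move_mul, flagA_move_slT, flagC_move_slE, flagA_move_slT,
    flagC_move_slE]

lemma flagC_move_holC (hX : ∀ i, 0 < X i) : flagC.move (holC hX) = flagC := by
  rw [holC, move_mul, move_mul, move_mul, flagC_move_slE, flagA_move_slT, flagC_move_slE,
    flagA_move_slT]

lemma flagB_move_holA (hX : ∀ i, 0 < X i) :
    (flagB (X 6)).move (holA hX) = (flagB (X 7)).move (slE (X 1) (X 0) (hX 1) (hX 0)) := by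
  rw [holA, move_mul, move_mul, move_mul, flagB_move_slT, flagA_move_slE, flagC_move_slT]

/-- As `β = (γ α)⁻¹`, this says that the holonomy of `β` fixes its flag; the two edge factors
between the rotations cancel. -/
lemma flagB_move_holC_holA (hX : ∀ i, 0 < X i) :
    ((flagB (X 6)).move (holA hX)).move (holC hX) = flagB (X 6) := by
  rw [flagB_move_holA, holC, move_mul, move_mul, move_mul, ← move_mul (slE _ _ _ _) (slE _ _ _ _),
    slE_mul_slE, move_one, flagB_move_slT, flagA_move_slE, flagC_move_slT]

/-- Up to a rotation, the vertex across `AB` is the standard neighbour across `AC`;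
`flagA_move_holC` does the same for `BC`. -/
lemma flagC_move_holA_inv (hX : ∀ i, 0 < X i) : flagC.move (holA hX)⁻¹ =
    ((flagB (X 7)).move (slE (X 3) (X 2) (hX 3) (hX 2))).move (slT (X 6) (hX 6))⁻¹ := by
  rw [holA, mul_inv_rev, mul_inv_rev, mul_inv_rev, ← mul_assoc, ← mul_assoc, move_mul, move_mul,
    move_mul, slE_inv, slE_inv, flagC_move_slE, move_inv_of_eq (flagB_move_slT (hX 7))]

lemma flagA_move_holC (hX : ∀ i, 0 < X i) : flagA.move (holC hX) =
    ((flagB (X 7)).move (slE (X 5) (X 4) (hX 5) (hX 4))).move (slT (X 6) (hX 6)) := by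
  rw [holC, move_mul, move_mul, move_mul, flagA_move_slE, flagC_move_slT]

/-- The holonomies of `α` and `γ` determine a representation of the fundamental group. -/
def homOf (a c : SL(3, ℝ)) : Pi1 →* SL(3, ℝ) :=
  PresentedGroup.toGroup (f := ![a, a⁻¹ * c⁻¹, c]) (by
    intro r hr
    rw [Set.mem_singleton_iff] at hr
    simp [hr])

@[simp] lemma homOf_α (a c : SL(3, ℝ)) : homOf a c α = a := by
  simp [homOf, α, loop]

@[simp] lemma homOf_β (a c : SL(3, ℝ)) : homOf a c β = a⁻¹ * c⁻¹ := by
  simp [homOf, β, loop]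

@[simp] lemma homOf_γ (a c : SL(3, ℝ)) : homOf a c γ = c := by
  simp [homOf, γ, loop]

/-- The standard framed representation with given coordinates. -/
def stdRep (hX : ∀ i, 0 < X i) : FramedRep where
  hol := homOf (holA hX) (holC hX)
  flag := ![flagA, flagB (X 6), flagC]
  fixed i := by
    fin_cases i
    · change flagA.move (homOf _ _ α) = flagA
      rw [homOf_α, flagA_move_holA]
    · change (flagB (X 6)).move (homOf _ _ β) = flagB (X 6)
      rw [homOf_β, ← mul_inv_rev]
      apply move_inv_of_eq
      rw [move_mul, flagB_move_holC_holA]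
    · change flagC.move (homOf _ _ γ) = flagC
      rw [homOf_γ, flagC_move_holC]

lemma coords_stdRep (hX : ∀ i, 0 < X i) : (stdRep hX).coords = X := by
  have hα : (stdRep hX).hol α = holA hX := homOf_α _ _
  have hγ : (stdRep hX).hol γ = holC hX := homOf_γ _ _
  have h0 : (stdRep hX).flag 0 = flagA := rfl
  have h1 : (stdRep hX).flag 1 = flagB (X 6) := rfl
  have h2 : (stdRep hX).flag 2 = flagC := rfl
  -- Invariance under the rotation turns the quadrilaterals over `AB` and over `BC` into the one
  -- over `CA`.
  have e2 : ∀ D : FullFlag, cr₂ flagA flagC (flagB (X 6)) (D.move (slT (X 6) (hX 6))⁻¹) =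
      cr₂ flagC (flagB (X 6)) flagA D := fun D => by
    refine (cr₂_move (slT (X 6) (hX 6)) _ _ _ _).symm.trans ?_
    rw [flagA_move_slT, flagC_move_slT, flagB_move_slT, ← move_mul, mul_inv_cancel, move_one]
  have e3 : ∀ D : FullFlag, cr₁ flagA flagC (flagB (X 6)) (D.move (slT (X 6) (hX 6))⁻¹) =
      cr₁ flagC (flagB (X 6)) flagA D := fun D => by
    refine (cr₁_move (slT (X 6) (hX 6)) _ _ _ _).symm.trans ?_
    rw [flagA_move_slT, flagC_move_slT, flagB_move_slT, ← move_mul, mul_inv_cancel, move_one]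
  have e4 : ∀ D : FullFlag, cr₂ (flagB (X 6)) flagA flagC (D.move (slT (X 6) (hX 6))) =
      cr₂ flagC (flagB (X 6)) flagA D := fun D => by
    refine Eq.trans ?_ (cr₂_move (slT (X 6) (hX 6)) _ _ _ _)
    rw [flagA_move_slT, flagC_move_slT, flagB_move_slT]
  have e5 : ∀ D : FullFlag, cr₁ (flagB (X 6)) flagA flagC (D.move (slT (X 6) (hX 6))) =
      cr₁ flagC (flagB (X 6)) flagA D := fun D => by
    refine Eq.trans ?_ (cr₁_move (slT (X 6) (hX 6)) _ _ _ _)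
    rw [flagA_move_slT, flagC_move_slT, flagB_move_slT]
  ext i
  simp only [FramedRep.coords, hα, hγ, h0, h1, h2, flagB_move_holA, flagC_move_holA_inv,
    flagA_move_holC, e2, e3, e4, e5, cr₁_first, cr₂_first, cr₁_adjacent, cr₂_adjacent,
    tripleRatio_std, tripleRatio_adjacent]
  fin_cases i <;> rfl

/-! ### Positive framed representations are determined by their coordinates -/

lemma β_eq : β = α⁻¹ * γ⁻¹ := by
  have rel : α * β * γ = 1 := by
    have : (PresentedGroup.mk _ (FreeGroup.of 0 * FreeGroup.of 1 * FreeGroup.of 2) : Pi1) = 1 :=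
      PresentedGroup.one_of_mem rfl
    simpa [α, β, γ, loop, PresentedGroup.of] using this
  rw [eq_mul_inv_iff_mul_eq]
  exact eq_inv_of_mul_eq_one_right (by rw [← mul_assoc, rel])

lemma hom_eq_of_eq {f g : Pi1 →* SL(3, ℝ)} (hα : f α = g α) (hγ : f γ = g γ) : f = g := by
  have hβ : f β = g β := by
    rw [β_eq, map_mul, map_mul, map_inv, map_inv, map_inv, map_inv, hα, hγ]
  refine PresentedGroup.ext fun i => ?_
  fin_cases i
  · exact hα
  · exact hβ
  · exact hγ

/-- The simultaneous action of `SL(3, ℝ)` on representations and framings. -/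
def FramedRep.conj (g : SL(3, ℝ)) (R : FramedRep) : FramedRep where
  hol := (MulAut.conj g).toMonoidHom.comp R.hol
  flag i := (R.flag i).move g
  fixed i := by
    change ((R.flag i).move g).move (g * R.hol (loop i) * g⁻¹) = _
    rw [← move_mul, mul_assoc, inv_mul_cancel, mul_one, move_mul, R.fixed]

lemma conjugates_conj (g : SL(3, ℝ)) (R : FramedRep) : Conjugates g R (R.conj g) :=
  ⟨fun _ => rfl, fun _ => rfl⟩

lemma joinEval_rotate (p q r : P2) : joinEval p q r = joinEval q r p := by
  simp only [joinEval, crossProduct, dotProduct, Fin.sum_univ_three, LinearMap.mk₂_apply]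
  simp
  ring

lemma tripleRatio_swap (F₁ F₂ F₃ : FullFlag) :
    tripleRatio F₁ F₂ F₃ = (tripleRatio F₁ F₃ F₂)⁻¹ := by
  rw [tripleRatio, tripleRatio, inv_div]
  congr 1 <;> ring

/-- With a common framing, the two holonomies of `α` agree on the flags `A` and `B` and on the point
of `ρ(α)⁻¹ C`; those of `γ` agree on the flags `C` and `ρ(α) B` and on the point of `A`. Rigidity
then gives equality. -/
lemma hol_eq_of_coords_eq {R S : FramedRep} (hpos : ∀ i, 0 < R.coords i)
    (h : R.coords = S.coords) (hflag : ∀ i, R.flag i = S.flag i) : R.hol = S.hol := by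
  obtain ⟨A, hA⟩ : ∃ A, R.flag 0 = A := ⟨_, rfl⟩
  obtain ⟨B, hB⟩ : ∃ B, R.flag 1 = B := ⟨_, rfl⟩
  obtain ⟨C, hC⟩ : ∃ C, R.flag 2 = C := ⟨_, rfl⟩
  obtain ⟨a, ha⟩ : ∃ a, R.hol α = a := ⟨_, rfl⟩
  obtain ⟨c, hc⟩ : ∃ c, R.hol γ = c := ⟨_, rfl⟩
  obtain ⟨a', ha'⟩ : ∃ a, S.hol α = a := ⟨_, rfl⟩
  obtain ⟨c', hc'⟩ : ∃ c, S.hol γ = c := ⟨_, rfl⟩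
  have fA : A.move a = A := by rw [← hA, ← ha]; exact R.fixed 0
  have fC : C.move c = C := by rw [← hC, ← hc]; exact R.fixed 2
  have fB : B.move (a⁻¹ * c⁻¹) = B := by
    rw [← hB, ← ha, ← hc, ← map_inv, ← map_inv, ← map_mul, ← β_eq]; exact R.fixed 1
  have fA' : A.move a' = A := by rw [← hA, ← ha', hflag]; exact S.fixed 0
  have fC' : C.move c' = C := by rw [← hC, ← hc', hflag]; exact S.fixed 2
  have fB' : B.move (a'⁻¹ * c'⁻¹) = B := by
    rw [← hB, ← ha', ← hc', ← map_inv, ← map_inv, ← map_mul, ← β_eq, hflag]; exact S.fixed 1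
  simp only [FramedRep.coords, ← hflag, hA, hB, hC, ha, hc, ha', hc'] at h
  have p := fun i => (hpos i).ne'
  simp only [FramedRep.coords, hA, hB, hC, ha, hc] at p
  have p0 : cr₁ A (B.move a) C B ≠ 0 := p 0
  have p1 : cr₂ A (B.move a) C B ≠ 0 := p 1
  have p2 : cr₂ A C B (C.move a⁻¹) ≠ 0 := p 2
  have p3 : cr₁ A C B (C.move a⁻¹) ≠ 0 := p 3
  have p4 : cr₂ B A C (A.move c) ≠ 0 := p 4
  have p5 : cr₁ B A C (A.move c) ≠ 0 := p 5
  have p6 : tripleRatio A C B ≠ 0 := p 6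
  have p7 : tripleRatio A (B.move a) C ≠ 0 := p 7
  have e0 : cr₁ A (B.move a) C B = cr₁ A (B.move a') C B := congrFun h 0
  have e1 : cr₂ A (B.move a) C B = cr₂ A (B.move a') C B := congrFun h 1
  have e2 : cr₂ A C B (C.move a⁻¹) = cr₂ A C B (C.move a'⁻¹) := congrFun h 2
  have e3 : cr₁ A C B (C.move a⁻¹) = cr₁ A C B (C.move a'⁻¹) := congrFun h 3
  have e4 : cr₂ B A C (A.move c) = cr₂ B A C (A.move c') := congrFun h 4
  have e5 : cr₁ B A C (A.move c) = cr₁ B A C (A.move c') := congrFun h 5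
  have e7 : tripleRatio A (B.move a) C = tripleRatio A (B.move a') C := congrFun h 7
  obtain ⟨⟨nAC, nAB⟩, ⟨nCA, nCB⟩, nBA, nBC⟩ := tripleRatio_ne_zero p6
  obtain ⟨-, ⟨nDA, nDC⟩, -, nCD⟩ := tripleRatio_ne_zero p7
  have hD : B.move a = B.move a' :=
    flag_eq_of_tripleRatio (second_point_eq nAC nCA p0 p1 e0 e1) (cr₁_ne_zero p0).2.2.1 p7 e7
  have hC' : a⁻¹ • C.point = a'⁻¹ • C.point := fourth_point_eq nAB nBA p3 p2 e3 e2
  have hA' : c • A.point = c' • A.point := fourth_point_eq nBC nCB p5 p4 e5 e4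
  have haa : a'⁻¹ * a = 1 := by
    refine eq_one_of_fixes (F := A) (G := B) (r := a⁻¹ • C.point) ?_ ?_ ?_ nAB nBA
      (cr₁_ne_zero p3).2.1 (cr₂_ne_zero p2).2.1 (cr₁_ne_zero p3).2.2.2
    · rw [move_mul, fA, move_inv_of_eq fA']
    · rw [move_mul, hD, move_inv_of_eq rfl]
    · rw [smul_smul, mul_assoc, mul_inv_cancel, mul_one, hC']
  have hcc : c'⁻¹ * c = 1 := by
    -- The framing of `β = (γ α)⁻¹` says that `γ` takes `ρ(α) B` to `B`. This supplies the second
    -- flag for `γ`.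
    have move_D : ∀ {x y : SL(3, ℝ)}, B.move (x⁻¹ * y⁻¹) = B → (B.move x).move y = B := by
      intro x y hxy
      rw [← move_mul]
      have := move_inv_of_eq hxy
      rwa [mul_inv_rev, inv_inv, inv_inv] at this
    refine eq_one_of_fixes (F := C) (G := B.move a) (r := A.point) ?_ ?_ ?_ nCD nDC nCA nDA ?_
    · rw [move_mul, fC, move_inv_of_eq fC']
    · rw [move_mul, move_D fB]
      conv_rhs => rw [hD]
      exact move_inv_of_eq (move_D fB')
    · rw [mul_smul, hA', smul_smul, inv_mul_cancel, one_smul]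
    · rw [← joinEval_rotate]
      exact (cr₁_ne_zero p0).2.2.1
  refine hom_eq_of_eq ?_ ?_
  · rw [ha, ha', eq_comm, ← inv_mul_eq_one, haa]
  · rw [hc, hc', eq_comm, ← inv_mul_eq_one, hcc]

/-- Real cube roots of either sign allow any invertible matrix to be rescaled to determinant one, as
in `PGL(3, ℝ) = SL(3, ℝ)`. -/
lemma exists_cube_root {x : ℝ} (hx : x ≠ 0) : ∃ d : ℝ, d ≠ 0 ∧ d ^ 3 = x := by
  rcases lt_or_gt_of_ne hx with h | h
  · refine ⟨-(-x) ^ (1 / 3 : ℝ), neg_ne_zero.2 (Real.rpow_pos_of_pos (neg_pos.2 h) _).ne', ?_⟩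
    rw [Odd.neg_pow (by decide), cbrt_pow (neg_pos.2 h), neg_neg]
  · exact ⟨x ^ (1 / 3 : ℝ), (Real.rpow_pos_of_pos h _).ne', cbrt_pow h⟩

lemma det_of_rows (a b c : ℝ) (l m p q : Fin 3 → ℝ) :
    (Matrix.of ![a • m, b • crossProduct p q, c • l]).det =
      a * b * c * (l ⬝ᵥ p * (m ⬝ᵥ q) - l ⬝ᵥ q * (m ⬝ᵥ p)) := by
  rw [Matrix.det_fin_three]
  simp only [dotProduct, Fin.sum_univ_three, crossProduct, LinearMap.mk₂_apply]
  simp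
  ring

/-- Flags in general position can be moved to the standard flags. -/
lemma exists_move_eq_std {A B C : FullFlag} (h : tripleRatio A C B ≠ 0)
    (hj : joinEval A.point C.point B.point ≠ 0) :
    ∃ g, A.move g = flagA ∧ B.move g = flagB (tripleRatio A C B) ∧ C.move g = flagC := by
  obtain ⟨⟨nAC, nAB⟩, ⟨nCA, nCB⟩, nBA, nBC⟩ := tripleRatio_ne_zero h
  -- The rows are the line of `C`, the join of `A` and `C`, and the line of `A`, scaled so that the
  -- point of `B` goes to `(1, -1, 1)`.
  set N : Matrix (Fin 3) (Fin 3) ℝ := Matrix.of ![(pairing C.line B.point)⁻¹ • C.line.rep,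
    -(joinEval A.point C.point B.point)⁻¹ • crossProduct A.point.rep C.point.rep,
    (pairing A.line B.point)⁻¹ • A.line.rep] with hN
  have hdet0 : N.det ≠ 0 := by
    rw [hN, det_of_rows]
    change _ * (pairing A.line A.point * pairing C.line C.point -
      pairing A.line C.point * pairing C.line A.point) ≠ 0
    rw [pairing_self, zero_mul, zero_sub]
    exact mul_ne_zero (mul_ne_zero (mul_ne_zero (inv_ne_zero nCB)
      (neg_ne_zero.2 (inv_ne_zero hj))) (inv_ne_zero nAB)) (neg_ne_zero.2 (mul_ne_zero nAC nCA))
  obtain ⟨d, hd, hd3⟩ := exists_cube_root hdet0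
  let g : SL(3, ℝ) := ⟨d⁻¹ • N, by
    rw [Matrix.det_smul, Fintype.card_fin, ← hd3, ← mul_pow, inv_mul_cancel₀ hd, one_pow]⟩
  have hg : ∀ v, g.1 *ᵥ v = d⁻¹ • ![(pairing C.line B.point)⁻¹ * (C.line.rep ⬝ᵥ v),
      -(joinEval A.point C.point B.point)⁻¹ * (crossProduct A.point.rep C.point.rep ⬝ᵥ v),
      (pairing A.line B.point)⁻¹ * (A.line.rep ⬝ᵥ v)] := by
    intro v
    change (d⁻¹ • N) *ᵥ v = _
    rw [Matrix.smul_mulVec]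
    congr 1
    ext i
    fin_cases i
    · exact smul_dotProduct (pairing C.line B.point)⁻¹ C.line.rep v
    · exact smul_dotProduct (-(joinEval A.point C.point B.point)⁻¹)
        (crossProduct A.point.rep C.point.rep) v
    · exact smul_dotProduct (pairing A.line B.point)⁻¹ A.line.rep v
  have hA : A.move g = flagA := by
    refine (A.isRep_self.move g (a := d⁻¹ * ((pairing C.line B.point)⁻¹ * pairing C.line A.point))
      (b := d⁻¹ * (pairing A.line B.point)⁻¹) ?_ ?_ ?_ ?_).eq isRep_flagA
    · exact mul_ne_zero (inv_ne_zero hd) (mul_ne_zero (inv_ne_zero nCB) nCA)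
    · exact mul_ne_zero (inv_ne_zero hd) (inv_ne_zero nAB)
    · rw [hg, mul_smul]
      congr 1
      have := pairing_self A
      simp only [pairing] at this ⊢
      ext i
      fin_cases i
      · simp
      · simp [dotProduct_comm _ A.point.rep]
      · simp [this]
    · change (d⁻¹ • N)ᵀ *ᵥ _ = _
      rw [Matrix.transpose_smul, Matrix.smul_mulVec, mul_smul]
      congr 1
      ext i
      simp [hN, Matrix.mulVec, dotProduct, Fin.sum_univ_three]
  have hC : C.move g = flagC := by
    refine (C.isRep_self.move g (a := d⁻¹ * ((pairing A.line B.point)⁻¹ * pairing A.line C.point))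
      (b := d⁻¹ * (pairing C.line B.point)⁻¹) ?_ ?_ ?_ ?_).eq isRep_flagC
    · exact mul_ne_zero (inv_ne_zero hd) (mul_ne_zero (inv_ne_zero nAB) nAC)
    · exact mul_ne_zero (inv_ne_zero hd) (inv_ne_zero nCB)
    · rw [hg, mul_smul]
      congr 1
      have := pairing_self C
      simp only [pairing] at this ⊢
      ext i
      fin_cases i
      · simp [this]
      · simp [dotProduct_comm _ C.point.rep]
      · simp
    · change (d⁻¹ • N)ᵀ *ᵥ _ = _
      rw [Matrix.transpose_smul, Matrix.smul_mulVec, mul_smul]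
      congr 1
      ext i
      simp [hN, Matrix.mulVec, dotProduct, Fin.sum_univ_three]
  have hBp : (B.move g).point = (flagB (tripleRatio A C B)).point := by
    refine (((rep_self B.point).smul g).of_smul (inv_ne_zero hd) ?_).eq (isRep_flagB _).point
    rw [hg]
    congr 1
    ext i
    fin_cases i
    · exact inv_mul_cancel₀ nCB
    · change -(joinEval A.point C.point B.point)⁻¹ * joinEval A.point C.point B.point = -1
      rw [neg_mul, inv_mul_cancel₀ hj]
    · exact inv_mul_cancel₀ nAB
  refine ⟨g, hA, ?_, hC⟩
  -- The point of `B` is already in place; its line is recovered from the triple ratio, inverted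
  -- because `B` now stands in the middle.
  have e : tripleRatio flagA (B.move g) flagC = (tripleRatio A C B)⁻¹ := by
    rw [tripleRatio_swap, ← hA, ← hC, tripleRatio_move]
  refine flag_eq_of_tripleRatio (F₁ := flagA) (F₃ := flagC) hBp ?_ ?_ ?_
  · obtain ⟨a, b, ha, hb, -, h4⟩ := move_scale g
    rw [← hA, ← hC, h4]
    exact mul_ne_zero (mul_ne_zero (mul_ne_zero (ha _) (ha _)) (ha _)) hj
  · rw [e]
    exact inv_ne_zero h
  · rw [e, tripleRatio_swap flagA, tripleRatio_std]

/-- A positive framed representation is conjugate to the standard one with its coordinates. -/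
lemma exists_conjugates_stdRep {R : FramedRep} (hpos : ∀ i, 0 < R.coords i) :
    ∃ g, Conjugates g R (stdRep hpos) := by
  have p0 : cr₁ (R.flag 0) ((R.flag 1).move (R.hol α)) (R.flag 2) (R.flag 1) ≠ 0 := (hpos 0).ne'
  have p6 : tripleRatio (R.flag 0) (R.flag 2) (R.flag 1) ≠ 0 := (hpos 6).ne'
  obtain ⟨g, hA, hB, hC⟩ := exists_move_eq_std p6 (cr₁_ne_zero p0).2.2.2
  have hcoords := coords_eq_of_conjugates (conjugates_conj g R)
  have hflag : ∀ i, (R.conj g).flag i = (stdRep hpos).flag i := by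
    intro i
    fin_cases i
    · exact hA
    · exact hB
    · exact hC
  have hhol : (R.conj g).hol = (stdRep hpos).hol := by
    refine hol_eq_of_coords_eq ?_ ?_ hflag
    · rw [← hcoords]; exact hpos
    · rw [← hcoords, coords_stdRep]
  exact ⟨g, fun c => by rw [← hhol]; rfl, fun i => by rw [← hflag]; rfl⟩

/-- The class with given positive coordinates. -/
def ofCoords {X : Fin 8 → ℝ} (hX : ∀ i, 0 < X i) : PosModuli :=
  ⟨⟦stdRep hX⟧, fun i => by
    change 0 < (stdRep hX).coords i
    rw [coords_stdRep]; exact hX i⟩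

lemma coords_ofCoords {X : Fin 8 → ℝ} (hX : ∀ i, 0 < X i) : coords (ofCoords hX) = X :=
  coords_stdRep hX

lemma mk_stdRep (x : PosModuli) : (⟦stdRep x.2⟧ : Moduli) = x.1 := by
  obtain ⟨x, hx⟩ := x
  induction x using Quotient.inductionOn with
  | h R =>
    obtain ⟨g, hg⟩ := exists_conjugates_stdRep (R := R) hx
    exact (Quotient.sound (s := FramedRep.setoid) (show ∃ g, Conjugates g R _ from ⟨g, hg⟩)).symm

lemma coords_injective : Function.Injective coords := by
  intro x y h
  have aux : ∀ (X Y : Fin 8 → ℝ) (hX : ∀ i, 0 < X i) (hY : ∀ i, 0 < Y i), X = Y →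
      stdRep hX = stdRep hY := by
    rintro X _ hX hY rfl
    rfl
  apply Subtype.ext
  exact (mk_stdRep x).symm.trans ((congrArg _ (aux _ _ x.2 y.2 h)).trans (mk_stdRep y))

lemma range_coords : Set.range coords = orthant := by
  ext X
  constructor
  · rintro ⟨x, rfl⟩
    exact x.2
  · intro hX
    exact ⟨ofCoords hX, coords_ofCoords hX⟩

lemma exists_hol_eq (x : PosModuli) : ∃ R : FramedRep, (⟦R⟧ : Moduli) = x.1 ∧
    (R.hol α).1 = matE (coords x 1) (coords x 0) * matT (coords x 7) *
      matE (coords x 2) (coords x 3) * matT (coords x 6) ∧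
    (R.hol γ).1 = matT (coords x 6) * matE (coords x 5) (coords x 4) *
      matT (coords x 7) * matE (coords x 0) (coords x 1) := by
  refine ⟨stdRep x.2, mk_stdRep x, ?_, ?_⟩
  · change (homOf _ _ α).1 = _
    rw [homOf_α]
    rfl
  · change (homOf _ _ γ).1 = _
    rw [homOf_γ]
    rfl

/-! ### The unipotent locus -/

lemma charpoly_upper (a b c d e f : ℝ) : (!![a, b, c; 0, d, e; 0, 0, f]).charpoly =
    (Polynomial.X - Polynomial.C a) * (Polynomial.X - Polynomial.C d) *
      (Polynomial.X - Polynomial.C f) := by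
  rw [Matrix.charpoly_of_isUpperTriangular]
  · simp [Fin.prod_univ_three]
  · intro i j hij
    fin_cases i <;> fin_cases j <;> first | rfl | (simp at hij)

lemma prod_X_sub_C_eq_iff (a b c : ℝ) :
    (Polynomial.X - Polynomial.C a) * (Polynomial.X - Polynomial.C b) *
      (Polynomial.X - Polynomial.C c) = (Polynomial.X - 1) ^ 3 ↔ a = 1 ∧ b = 1 ∧ c = 1 := by
  constructor
  · intro h
    have key : ∀ t : ℝ, (t - a) * (t - b) * (t - c) = (t - 1) ^ 3 := by
      intro t
      simpa using congrArg (Polynomial.eval t) h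
    have aux : ∀ t : ℝ, (t - 1) ^ 3 = 0 → t = 1 := by
      intro t ht
      linarith [pow_eq_zero_iff (n := 3) (by norm_num) |>.1 ht]
    exact ⟨aux a (by rw [← key a]; ring), aux b (by rw [← key b]; ring),
      aux c (by rw [← key c]; ring)⟩
  · rintro ⟨rfl, rfl, rfl⟩
    simp only [map_one]
    ring

lemma matE_mul_matT (z w x : ℝ) : matE z w * matT x =
    (z ^ (1 / 3 : ℝ) / w ^ (1 / 3 : ℝ) * (1 / x ^ (1 / 3 : ℝ))) •
      !![x / z, (1 + x) / z, 1 / z; 0, 1, 1; 0, 0, w] := by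
  rw [matE, matT, smul_mul_smul_comm]
  congr 1
  ext i j
  fin_cases i <;> fin_cases j <;> simp [Matrix.mul_apply, Fin.sum_univ_three] <;> ring

/-- Each `matE * matT` fixes `flagA`, so the product is upper triangular with diagonal `s x x' / (z
z')`, `s`, `s w w'`, where `s` is the product of the scalar prefactors. For the converse,
determinant one gives `s ^ 3 = 1`, hence `s = 1`. -/
lemma charpoly_matE_matT {z w x z' w' x' : ℝ} (hz : 0 < z) (hw : 0 < w) (hx : 0 < x)
    (hz' : 0 < z') (hw' : 0 < w') (hx' : 0 < x') :
    (matE z w * matT x * matE z' w' * matT x').charpoly = (Polynomial.X - 1) ^ 3 ↔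
      w * w' = 1 ∧ x * x' = z * z' := by
  set s := (z ^ (1 / 3 : ℝ) / w ^ (1 / 3 : ℝ) * (1 / x ^ (1 / 3 : ℝ))) *
    (z' ^ (1 / 3 : ℝ) / w' ^ (1 / 3 : ℝ) * (1 / x' ^ (1 / 3 : ℝ))) with hs
  have hs0 : 0 < s := by positivity
  have hs3 : s ^ 3 * (w * w' * (x * x')) = z * z' := by
    rw [hs, mul_pow, mul_pow, mul_pow, div_pow, div_pow, div_pow, div_pow, cbrt_pow hz,
      cbrt_pow hw, cbrt_pow hx, cbrt_pow hz', cbrt_pow hw', cbrt_pow hx']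
    field_simp
  have hprod : matE z w * matT x * matE z' w' * matT x' =
      !![s * (x / z * (x' / z')), s * (x / z * ((1 + x') / z') + (1 + x) / z),
        s * (x / z * (1 / z') + (1 + x) / z + 1 / z * w'); 0, s * 1, s * (1 + w');
        0, 0, s * (w * w')] := by
    rw [mul_assoc, matE_mul_matT, matE_mul_matT, smul_mul_smul_comm, ← hs]
    ext i j
    fin_cases i <;> fin_cases j <;> simp
    left
    ring
  rw [hprod, charpoly_upper, prod_X_sub_C_eq_iff]
  constructor
  · rintro ⟨h1, h2, h3⟩
    rw [mul_one] at h2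
    rw [h2, one_mul] at h1 h3
    refine ⟨h3, ?_⟩
    field_simp at h1
    exact h1
  · rintro ⟨h1, h2⟩
    rw [h1, h2, one_mul] at hs3
    have h3 : s ^ 3 = 1 := by
      have : z * z' ≠ 0 := (mul_pos hz hz').ne'
      exact mul_right_cancel₀ this (hs3.trans (one_mul _).symm)
    have h4 : s = 1 := (pow_eq_one_iff_of_nonneg hs0.le (by norm_num)).1 h3
    rw [h4, one_mul, one_mul, one_mul]
    refine ⟨?_, rfl, h1⟩
    field_simp
    exact h2

lemma isUnipotent_conj (g h : SL(3, ℝ)) : IsUnipotent (g * h * g⁻¹) ↔ IsUnipotent h := by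
  unfold IsUnipotent
  rw [Matrix.SpecialLinearGroup.coe_mul, Matrix.charpoly_mul_comm,
    ← Matrix.SpecialLinearGroup.coe_mul, ← mul_assoc, inv_mul_cancel, one_mul]

lemma slT_pow {x : ℝ} (hx : 0 < x) : slT x hx * slT x hx * slT x hx = 1 := by
  have h0 : x ^ (1 / 3 : ℝ) ≠ 0 := (Real.rpow_pos_of_pos hx _).ne'
  have h1 : 1 / x ^ (1 / 3 : ℝ) * (1 / x ^ (1 / 3 : ℝ)) * (1 / x ^ (1 / 3 : ℝ)) = 1 / x := by
    conv_rhs => rw [← cbrt_pow hx]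
    field_simp
  apply Subtype.ext
  change matT x * matT x * matT x = 1
  rw [matT, smul_mul_smul_comm, smul_mul_smul_comm, h1]
  have hxx := hx.ne'
  ext i j
  fin_cases i <;> fin_cases j <;> simp [hxx]

lemma isUnipotent_holA (hX : ∀ i, 0 < X i) :
    IsUnipotent (holA hX) ↔ X 0 * X 3 = 1 ∧ X 7 * X 6 = X 1 * X 2 :=
  charpoly_matE_matT (hX 1) (hX 0) (hX 7) (hX 2) (hX 3) (hX 6)

lemma isUnipotent_holC (hX : ∀ i, 0 < X i) :
    IsUnipotent (holC hX) ↔ X 4 * X 1 = 1 ∧ X 7 * X 6 = X 5 * X 0 := by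
  rw [← charpoly_matE_matT (hX 5) (hX 4) (hX 7) (hX 0) (hX 1) (hX 6)]
  unfold IsUnipotent
  have : (holC hX).1 = matT (X 6) * (matE (X 5) (X 4) * matT (X 7) * matE (X 0) (X 1)) := by
    simp only [← mul_assoc]
    rfl
  rw [this, Matrix.charpoly_mul_comm]

/-- Conjugating by a rotation and using `T⁻² = T` and `E(z, w)⁻¹ = E(w, z)` brings `(γ α)⁻¹` to the
same shape `E T E T` as `α`. -/
lemma isUnipotent_holB (hX : ∀ i, 0 < X i) :
    IsUnipotent ((holA hX)⁻¹ * (holC hX)⁻¹) ↔ X 2 * X 5 = 1 ∧ X 7 * X 6 = X 3 * X 4 := by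
  have e : slT (X 6) (hX 6) * ((holA hX)⁻¹ * (holC hX)⁻¹) * (slT (X 6) (hX 6))⁻¹ =
      slE (X 3) (X 2) (hX 3) (hX 2) * slT (X 7) (hX 7) * slE (X 4) (X 5) (hX 4) (hX 5) *
        slT (X 6) (hX 6) := by
    have h6 : (slT (X 6) (hX 6))⁻¹ * (slT (X 6) (hX 6))⁻¹ = slT (X 6) (hX 6) := by
      rw [← mul_inv_rev]
      exact inv_eq_of_mul_eq_one_right (slT_pow _)
    have h7 : (slT (X 7) (hX 7))⁻¹ * (slT (X 7) (hX 7))⁻¹ = slT (X 7) (hX 7) := by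
      rw [← mul_inv_rev]
      exact inv_eq_of_mul_eq_one_right (slT_pow _)
    rw [holA, holC]
    conv_rhs => rw [← h6, ← h7, ← slE_inv (hX 2) (hX 3), ← slE_inv (hX 5) (hX 4)]
    rw [← slE_inv (hX 0) (hX 1)]
    group
  rw [← isUnipotent_conj (slT (X 6) (hX 6)), e]
  exact charpoly_matE_matT (hX 3) (hX 2) (hX 7) (hX 4) (hX 5) (hX 6)

lemma mem_unipotentLocus_iff_isUnipotent (x : PosModuli) : x ∈ unipotentLocus ↔
    IsUnipotent (holA x.2) ∧ IsUnipotent ((holA x.2)⁻¹ * (holC x.2)⁻¹) ∧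
      IsUnipotent (holC x.2) := by
  have hα : (stdRep x.2).hol α = holA x.2 := homOf_α _ _
  have hβ : (stdRep x.2).hol β = (holA x.2)⁻¹ * (holC x.2)⁻¹ := homOf_β _ _
  have hγ : (stdRep x.2).hol γ = holC x.2 := homOf_γ _ _
  constructor
  · rintro ⟨R, hR, hu⟩
    obtain ⟨g, hg, -⟩ : ∃ g, Conjugates g R (stdRep x.2) :=
      Quotient.exact (s := FramedRep.setoid) (hR.trans (mk_stdRep x).symm)
    rw [← hβ, ← hα, ← hγ, hg, hg, hg, isUnipotent_conj, isUnipotent_conj, isUnipotent_conj]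
    exact ⟨hu 0, hu 1, hu 2⟩
  · rintro ⟨h1, h2, h3⟩
    rw [← hα] at h1
    rw [← hβ] at h2
    rw [← hγ] at h3
    refine ⟨stdRep x.2, mk_stdRep x, fun i => ?_⟩
    match i with
    | 0 => exact h1
    | 1 => exact h2
    | 2 => exact h3

/-- The point of the unipotent locus with given `σ₁` and `τ₁`, in coordinates. -/
def leafPoint (x y : ℝ) : Fin 8 → ℝ := ![x, 1 / x, x, 1 / x, x, 1 / x, y, 1 / y]

/-- Put `P = τ₁ τ₂`. The three relations for `P` multiply to `P³ = σ₁ ⋯ σ₆`, which is `1` by the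
other three; positivity gives `P = 1`, and the remaining equations are solved by substitution. -/
lemma mem_unipotentLocus_iff (x : PosModuli) :
    x ∈ unipotentLocus ↔ coords x = leafPoint (σ₁ x) (τ₁ x) := by
  rw [mem_unipotentLocus_iff_isUnipotent, isUnipotent_holA, isUnipotent_holB, isUnipotent_holC]
  change ((coords x 0 * coords x 3 = 1 ∧ coords x 7 * coords x 6 = coords x 1 * coords x 2) ∧
    (coords x 2 * coords x 5 = 1 ∧ coords x 7 * coords x 6 = coords x 3 * coords x 4) ∧
    (coords x 4 * coords x 1 = 1 ∧ coords x 7 * coords x 6 = coords x 5 * coords x 0)) ↔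
    coords x = leafPoint (coords x 0) (coords x 6)
  have hX : ∀ i, 0 < coords x i := x.2
  generalize coords x = X at hX
  have n := fun i => (hX i).ne'
  have h0 := n 0
  have h1 := n 1
  have h2 := n 2
  have h6 := n 6
  constructor
  · rintro ⟨⟨a1, a2⟩, ⟨b1, b2⟩, c1, c2⟩
    have e3 : X 3 = 1 / X 0 := by field_simp; linarith
    have e5 : X 5 = 1 / X 2 := by field_simp; linarith
    have e4 : X 4 = 1 / X 1 := by field_simp; linarith
    have p1 : X 7 * X 6 * X 0 * X 1 = 1 := by rw [b2, e3, e4]; field_simp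
    have p2 : X 7 * X 6 * X 2 = X 0 := by rw [c2, e5]; field_simp
    have hP : 0 < X 7 * X 6 := mul_pos (hX 7) (hX 6)
    have p3 : (X 7 * X 6) ^ 3 = 1 := by
      linear_combination (X 7 * X 6) ^ 2 * a2 + X 7 * X 6 * X 1 * p2 + p1
    have hP1 : X 7 * X 6 = 1 := (pow_eq_one_iff_of_nonneg hP.le (by norm_num)).1 p3
    rw [hP1, one_mul] at p1 p2
    have e1 : X 1 = 1 / X 0 := by field_simp; linarith
    have e7 : X 7 = 1 / X 6 := by field_simp; linarith
    ext i
    fin_cases i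
    · rfl
    · exact e1
    · exact p2
    · exact e3
    · change X 4 = X 0
      rw [e4, e1, one_div_one_div]
    · change X 5 = 1 / X 0
      rw [e5, p2]
    · rfl
    · exact e7
  · intro h
    have e : ∀ i, X i = leafPoint (X 0) (X 6) i := congrFun h
    have e1 : X 1 = 1 / X 0 := e 1
    have e2 : X 2 = X 0 := e 2
    have e3 : X 3 = 1 / X 0 := e 3
    have e4 : X 4 = X 0 := e 4
    have e5 : X 5 = 1 / X 0 := e 5
    have e7 : X 7 = 1 / X 6 := e 7
    rw [e1, e2, e3, e4, e5, e7]
    refine ⟨⟨?_, ?_⟩, ⟨?_, ?_⟩, ?_, ?_⟩ <;> field_simp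

/-! ### Global solutions of ordinary differential equations -/

/-- A bounded Lipschitz vector field has global integral curves. -/
lemma exists_global_solution {E : Type*} [NormedAddCommGroup E] [NormedSpace ℝ E]
    [CompleteSpace E] {v : E → E} {K L : NNReal} (hv : LipschitzWith K v) (hL : ∀ x, ‖v x‖ ≤ L)
    (x : E) : ∃ u : ℝ → E, u 0 = x ∧ ∀ t, HasDerivAt u (v (u t)) t := by
  have loc : ∀ n : ℕ, ∃ u : ℝ → E, u 0 = x ∧
      ∀ t ∈ Set.Ioo (-(n + 1 : ℝ)) (n + 1), HasDerivAt u (v (u t)) t := by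
    intro n
    have hn : (0 : ℝ) ≤ n + 1 := by positivity
    have h0 : (0 : ℝ) ∈ Set.Icc (-(n + 1 : ℝ)) (n + 1) := ⟨by linarith, hn⟩
    -- Speed at most `L` keeps the curve within distance `L (n + 1)` for times up to `n + 1`, so the
    -- existence time is the whole interval.
    have hPL : IsPicardLindelof (fun _ => v) ⟨0, h0⟩ x (L * (n + 1)) 0 L K := by
      refine IsPicardLindelof.of_time_independent (fun y _ => hL y) hv.lipschitzOnWith ?_
      simp
    obtain ⟨u, hu0, hu⟩ := hPL.exists_eq_forall_mem_Icc_hasDerivWithinAt₀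
    exact ⟨u, hu0, fun t ht => (hu t (Set.Ioo_subset_Icc_self ht)).hasDerivAt
      (Icc_mem_nhds ht.1 ht.2)⟩
  choose u hu0 hu using loc
  have agree : ∀ m n : ℕ, m ≤ n → ∀ t : ℝ, |t| < m + 1 → u m t = u n t := by
    intro m n hmn t ht
    have hmn' : (m : ℝ) ≤ n := Nat.cast_le.2 hmn
    refine ODE_solution_unique_of_mem_Ioo (v := fun _ => v) (s := fun _ => Set.univ) (K := K)
      (a := -(m + 1 : ℝ)) (b := m + 1) (t₀ := 0) (fun _ _ => hv.lipschitzOnWith) ?_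
      (fun s hs => ⟨hu m s hs, trivial⟩)
      (fun s hs => ⟨hu n s ⟨by linarith [hs.1], by linarith [hs.2]⟩, trivial⟩)
      ((hu0 m).trans (hu0 n).symm) (abs_lt.1 ht)
    have : (0 : ℝ) < m + 1 := by positivity
    exact ⟨by linarith, this⟩
  have key : ∀ (n : ℕ) (t : ℝ), |t| < n + 1 → u ⌈|t|⌉₊ t = u n t := by
    intro n t ht
    rcases le_total ⌈|t|⌉₊ n with h | h
    · exact agree _ _ h t (lt_of_le_of_lt (Nat.le_ceil _) (lt_add_one _))
    · exact (agree _ _ h t ht).symm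
  -- The index varies with `t`, but near a given time a single local solution represents the glued
  -- curve.
  refine ⟨fun t => u ⌈|t|⌉₊ t, by simp [hu0], fun t => ?_⟩
  have ht : |t| < (⌈|t|⌉₊ : ℝ) + 1 := lt_of_le_of_lt (Nat.le_ceil _) (lt_add_one _)
  refine (hu ⌈|t|⌉₊ t (abs_lt.1 ht)).congr_of_eventuallyEq ?_
  filter_upwards [(continuous_abs.tendsto t).eventually (gt_mem_nhds ht)] with s hs
  exact key _ _ hs

/-! ### Planar Hamiltonian systems -/

/-- The Hamiltonian vector field of `F` for the Poisson bracket with `{s, t} = 2` on the plane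
with the coordinate `s + t i`. -/
def planarField (F : ℂ → ℝ) (z : ℂ) : ℂ :=
  (2 * fderiv ℝ F z Complex.I : ℝ) - (2 * fderiv ℝ F z 1 : ℝ) * Complex.I

lemma fderiv_apply_eq (F : ℂ → ℝ) (z w : ℂ) :
    fderiv ℝ F z w = w.re * fderiv ℝ F z 1 + w.im * fderiv ℝ F z Complex.I := by
  have h : w = w.re • (1 : ℂ) + w.im • Complex.I := by
    simp [Complex.re_add_im]
  conv_lhs => rw [h, map_add, map_smul, map_smul, smul_eq_mul, smul_eq_mul]

lemma planarField_re (F : ℂ → ℝ) (z : ℂ) :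
    (planarField F z).re = 2 * fderiv ℝ F z Complex.I := by
  simp [planarField]

lemma planarField_im (F : ℂ → ℝ) (z : ℂ) : (planarField F z).im = -(2 * fderiv ℝ F z 1) := by
  simp [planarField]

lemma fderiv_planarField (F : ℂ → ℝ) (z : ℂ) : fderiv ℝ F z (planarField F z) = 0 := by
  rw [fderiv_apply_eq, planarField_re, planarField_im]
  ring

/-- A smooth function on the plane with bounded sublevel sets that increases strictly along the
rays from the point `p`. -/
structure IsRadial (F : ℂ → ℝ) (p : ℂ) : Prop where
  smooth : ContDiff ℝ ∞ F
  bounded : ∀ c, Bornology.IsBounded {z | F z ≤ c}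
  radial : ∀ z, z ≠ p → 0 < fderiv ℝ F z (z - p)

namespace IsRadial

variable {F : ℂ → ℝ} {p : ℂ}

lemma differentiable (h : IsRadial F p) : Differentiable ℝ F := h.smooth.differentiable (by simp)

lemma hasFDerivAt (h : IsRadial F p) (z : ℂ) : HasFDerivAt F (fderiv ℝ F z) z :=
  (h.differentiable z).hasFDerivAt

lemma strictMonoOn_ray (h : IsRadial F p) {w : ℂ} (hw : w ≠ 0) :
    StrictMonoOn (fun r : ℝ => F (p + r • w)) (Set.Ici 0) := by
  have hd : ∀ r : ℝ, HasDerivAt (fun r : ℝ => F (p + r • w)) (fderiv ℝ F (p + r • w) w) r := by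
    intro r
    have h1 : HasDerivAt (fun r : ℝ => p + r • w) w r := by
      simpa using ((hasDerivAt_id r).smul_const w).const_add p
    exact (h.hasFDerivAt _).comp_hasDerivAt r h1
  refine strictMonoOn_of_deriv_pos (convex_Ici 0)
    (fun r _ => (hd r).continuousAt.continuousWithinAt) fun r hr => ?_
  rw [interior_Ici, Set.mem_Ioi] at hr
  rw [(hd r).deriv]
  have := h.radial (p + r • w) (by simpa using ⟨hr.ne', hw⟩)
  rw [add_sub_cancel_left, map_smul, smul_eq_mul] at this
  exact pos_of_mul_pos_right this hr.le

lemma lt (h : IsRadial F p) {z : ℂ} (hz : z ≠ p) : F p < F z := by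
  have := h.strictMonoOn_ray (sub_ne_zero.2 hz) (Set.mem_Ici.2 le_rfl)
    (Set.mem_Ici.2 zero_le_one) one_pos
  simpa using this

/-- Zeros of the field are critical points of `F`; away from `p` the radial derivative is positive,
and `p` is a minimum. -/
lemma planarField_eq_zero_iff (h : IsRadial F p) (z : ℂ) : planarField F z = 0 ↔ z = p := by
  constructor
  · intro h0
    by_contra hz
    have h1 := h.radial z hz
    have h2 := planarField_re F z
    have h3 := planarField_im F z
    rw [h0] at h2 h3
    simp only [Complex.zero_re, Complex.zero_im] at h2 h3
    rw [fderiv_apply_eq, show fderiv ℝ F z 1 = 0 by linarith,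
      show fderiv ℝ F z Complex.I = 0 by linarith] at h1
    simp at h1
  · rintro rfl
    have : IsLocalMin F z := Filter.Eventually.of_forall fun y => by
      rcases eq_or_ne y z with rfl | hy
      · exact le_rfl
      · exact (h.lt hy).le
    simp [planarField, this.fderiv_eq_zero]

lemma contDiff_planarField (h : IsRadial F p) : ContDiff ℝ ∞ (planarField F) := by
  have h1 : ContDiff ℝ ∞ (fderiv ℝ F) := h.smooth.fderiv_right (by simp)
  have h2 : ∀ w : ℂ, ContDiff ℝ ∞ fun z => 2 * fderiv ℝ F z w := fun w =>
    contDiff_const.mul (h1.clm_apply contDiff_const)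
  have h3 : ∀ w : ℂ, ContDiff ℝ ∞ fun z => ((2 * fderiv ℝ F z w : ℝ) : ℂ) := fun w =>
    Complex.ofRealCLM.contDiff.comp (h2 w)
  exact (h3 Complex.I).sub ((h3 1).mul contDiff_const)

/-- A globally Lipschitz vector field that agrees with the Hamiltonian one on a sublevel set. -/
lemma exists_cutoff (h : IsRadial F p) (c : ℝ) :
    ∃ (v : ℂ → ℂ) (K L : NNReal), LipschitzWith K v ∧ (∀ z, ‖v z‖ ≤ L) ∧
      (∀ z, F z ≤ c → v z = planarField F z) ∧ ∀ z, fderiv ℝ F z (v z) = 0 := by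
  -- The factor is one where `F ≤ c` and zero where `F ≥ c + 1`, giving compact support. Rescaling
  -- the Hamiltonian field pointwise keeps it tangent to the level sets of `F`.
  let v : ℂ → ℂ := fun z => Real.smoothTransition (c + 1 - F z) • planarField F z
  have hv : ContDiff ℝ ∞ v :=
    (Real.smoothTransition.contDiff.comp (contDiff_const.sub h.smooth)).smul
      h.contDiff_planarField
  have hsupp : HasCompactSupport v := by
    refine HasCompactSupport.of_support_subset_isCompact (K := {z | F z ≤ c + 1})
      (Metric.isCompact_of_isClosed_isBounded
        (isClosed_le h.smooth.continuous continuous_const) (h.bounded _)) ?_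
    intro z hz
    by_contra hc
    apply hz
    have : c + 1 - F z ≤ 0 := by
      simp only [Set.mem_ofPred_eq, not_le] at hc
      linarith
    simp [v, Real.smoothTransition.zero_of_nonpos this]
  obtain ⟨K, hK⟩ := ContDiff.lipschitzWith_of_hasCompactSupport hsupp hv (by simp)
  obtain ⟨L, hL⟩ := hsupp.exists_bound_of_continuous hv.continuous
  refine ⟨v, K, L.toNNReal, hK, fun z => (hL z).trans (Real.le_coe_toNNReal L), ?_, ?_⟩
  · intro z hz
    simp [v, Real.smoothTransition.one_of_one_le (show 1 ≤ c + 1 - F z by linarith)]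
  · intro z
    rw [map_smul, fderiv_planarField, smul_zero]

lemma const_of_hasDerivAt (h : IsRadial F p) {v : ℂ → ℂ} (hv : ∀ z, fderiv ℝ F z (v z) = 0)
    {u : ℝ → ℂ} (hu : ∀ t, HasDerivAt u (v (u t)) t) (t : ℝ) : F (u t) = F (u 0) := by
  have hd : ∀ t, HasDerivAt (fun t => F (u t)) 0 t := fun t => by
    have := (h.hasFDerivAt (u t)).comp_hasDerivAt t (hu t)
    rwa [hv] at this
  exact is_const_of_deriv_eq_zero (fun t => (hd t).differentiableAt) (fun t => (hd t).deriv) t 0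

/-- The integral curve of the cut-off field conserves `F`, hence never leaves the region where the
cut-off is inactive. -/
lemma exists_solution (h : IsRadial F p) (z : ℂ) :
    ∃ u : ℝ → ℂ, u 0 = z ∧ ∀ t, HasDerivAt u (planarField F (u t)) t := by
  obtain ⟨v, K, L, hK, hL, hv, hF⟩ := h.exists_cutoff (F z)
  obtain ⟨u, hu0, hu⟩ := exists_global_solution hK hL z
  refine ⟨u, hu0, fun t => ?_⟩
  have := h.const_of_hasDerivAt hF hu t
  rw [hu0] at this
  rw [← hv _ this.le]
  exact hu t

/-- The field need not be globally Lipschitz, but both curves stay on one level set, where it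
coincides with a Lipschitz field. -/
lemma solution_unique (h : IsRadial F p) {u w : ℝ → ℂ}
    (hu : ∀ t, HasDerivAt u (planarField F (u t)) t)
    (hw : ∀ t, HasDerivAt w (planarField F (w t)) t) (h0 : u 0 = w 0) : u = w := by
  obtain ⟨v, K, L, hK, hL, hv, hF⟩ := h.exists_cutoff (F (u 0))
  refine ODE_solution_unique_univ (v := fun _ => v) (s := fun _ => Set.univ) (K := K) (t₀ := 0)
    (fun _ => hK.lipschitzOnWith) (fun t => ⟨?_, trivial⟩) (fun t => ⟨?_, trivial⟩) h0
  · rw [hv _ (h.const_of_hasDerivAt (fderiv_planarField F) hu t).le]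
    exact hu t
  · rw [hv _ ((h.const_of_hasDerivAt (fderiv_planarField F) hw t).trans (by rw [h0])).le]
    exact hw t

/-- The angular velocity around `p`. -/
lemma im_planarField_div (F : ℂ → ℝ) (p z : ℂ) :
    (planarField F z / (z - p)).im = -(2 * fderiv ℝ F z (z - p) / Complex.normSq (z - p)) := by
  rw [Complex.div_im, planarField_re, planarField_im, fderiv_apply_eq F z (z - p)]
  ring

lemma periodic_of_eq (h : IsRadial F p) {u : ℝ → ℂ}
    (hu : ∀ t, HasDerivAt u (planarField F (u t)) t) {T : ℝ} (hT : u T = u 0) :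
    Function.Periodic u T := by
  have : (fun t => u (t + T)) = u := by
    refine h.solution_unique (fun t => ?_) hu (by simpa using hT)
    exact (hu (t + T)).comp_add_const t T
  exact congrFun this

/-- All orbits of the Hamiltonian flow are periodic. -/
lemma exists_period (h : IsRadial F p) {u : ℝ → ℂ}
    (hu : ∀ t, HasDerivAt u (planarField F (u t)) t) : ∃ T > 0, Function.Periodic u T := by
  by_cases hp : u 0 = p
  · refine ⟨1, one_pos, h.periodic_of_eq hu ?_⟩
    have : u = fun _ => p := h.solution_unique hu (fun t => by
      rw [(h.planarField_eq_zero_iff p).2 rfl]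
      exact hasDerivAt_const t p) hp
    rw [this]
  have hc := h.const_of_hasDerivAt (fderiv_planarField F) hu
  have hne : ∀ t, u t ≠ p := by
    intro t ht
    have := hc t
    rw [ht] at this
    exact (h.lt hp).ne this
  have hcont : Continuous u := continuous_iff_continuousAt.2 fun t => (hu t).continuousAt
  have hw0 : u 0 - p ≠ 0 := sub_ne_zero.2 hp
  -- the logarithmic derivative and its lower bound
  have hvc : Continuous (planarField F) := h.contDiff_planarField.continuous
  obtain ⟨m, hm, hbound⟩ : ∃ m > 0, ∀ t, m ≤ -(planarField F (u t) / (u t - p)).im := by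
    have hK : IsCompact {z | F z = F (u 0)} :=
      Metric.isCompact_of_isClosed_isBounded (isClosed_eq h.smooth.continuous continuous_const)
        ((h.bounded (F (u 0))).subset fun z hz => le_of_eq hz)
    have hcK : ContinuousOn (fun z => -(planarField F z / (z - p)).im) {z | F z = F (u 0)} := by
      refine (Complex.continuous_im.comp_continuousOn (hvc.continuousOn.div
        (continuous_id.sub continuous_const).continuousOn fun z hz => ?_)).neg
      refine sub_ne_zero.2 ?_
      rintro rfl
      exact (h.lt hp).ne hz
    obtain ⟨z, hz, hmin⟩ := hK.exists_isMinOn ⟨u 0, rfl⟩ hcK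
    refine ⟨_, ?_, fun t => hmin (hc t)⟩
    have hzp : z ≠ p := by
      rintro rfl
      exact (h.lt hp).ne hz
    change 0 < -(planarField F z / (z - p)).im
    rw [im_planarField_div, neg_neg]
    exact div_pos (mul_pos two_pos (h.radial z hzp))
      (Complex.normSq_pos.2 (sub_ne_zero.2 hzp))
  have hqc : Continuous fun t => planarField F (u t) / (u t - p) :=
    (hvc.comp hcont).div (hcont.sub continuous_const) fun t => sub_ne_zero.2 (hne t)
  let q : ℝ → ℂ := fun t => planarField F (u t) / (u t - p)
  -- `Q` is a continuous logarithm of `(u t - p) / (u 0 - p)`; its imaginary part is the angle swept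
  -- around `p`.
  let Q : ℝ → ℂ := fun t => ∫ s in (0 : ℝ)..t, q s
  have hQ : ∀ t, HasDerivAt Q (q t) t := fun t =>
    intervalIntegral.integral_hasDerivAt_right (hqc.intervalIntegrable _ _)
      (hqc.stronglyMeasurableAtFilter _ _) hqc.continuousAt
  have hQ0 : Q 0 = 0 := intervalIntegral.integral_same
  have hpolar : ∀ t, u t - p = (u 0 - p) * Complex.exp (Q t) := by
    have hd : ∀ t, HasDerivAt (fun t => (u t - p) * Complex.exp (-Q t)) 0 t := by
      intro t
      have h1 := ((hu t).sub_const p).mul (hQ t).neg.cexp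
      refine h1.congr_deriv ?_
      have : q t * (u t - p) = planarField F (u t) := div_mul_cancel₀ _ (sub_ne_zero.2 (hne t))
      rw [← this]
      ring
    intro t
    have := is_const_of_deriv_eq_zero (fun t => (hd t).differentiableAt)
      (fun t => (hd t).deriv) t 0
    simp only [hQ0, neg_zero, Complex.exp_zero, mul_one] at this
    rw [← this, mul_assoc, ← Complex.exp_add, neg_add_cancel, Complex.exp_zero, mul_one]
  have hθ : ∀ t, 0 ≤ t → m * t ≤ -(Q t).im := by
    have hd : ∀ t, HasDerivAt (fun t => -(Q t).im - m * t) (-(q t).im - m) t := by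
      intro t
      have h1 : HasDerivAt (fun t => (Q t).im) (q t).im t :=
        Complex.imCLM.hasFDerivAt.comp_hasDerivAt t (hQ t)
      have h2 : HasDerivAt (fun t : ℝ => m * t) m t := by
        simpa using (hasDerivAt_id t).const_mul m
      exact h1.neg.sub h2
    have hmono : Monotone fun t => -(Q t).im - m * t :=
      monotone_of_deriv_nonneg (fun t => (hd t).differentiableAt) fun t => by
        rw [(hd t).deriv]
        exact sub_nonneg.2 (hbound t)
    intro t ht
    have := hmono ht
    simp only [hQ0, Complex.zero_im, neg_zero, mul_zero, sub_zero] at this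
    linarith
  -- The motion is clockwise at rate at least `m`, so a full turn is completed by time `2π / m`.
  obtain ⟨T, hT, hTθ⟩ : ∃ T ∈ Set.Icc 0 (2 * Real.pi / m), -(Q T).im = 2 * Real.pi := by
    have hpi : 0 ≤ 2 * Real.pi / m := by positivity
    have hQc : Continuous fun t => -(Q t).im :=
      (Complex.continuous_im.comp
        (continuous_iff_continuousAt.2 fun t => (hQ t).continuousAt)).neg
    refine intermediate_value_Icc hpi hQc.continuousOn ⟨?_, ?_⟩
    · simp [hQ0, Real.pi_pos.le]
    · have := hθ _ hpi
      rwa [mul_div_cancel₀ _ hm.ne'] at this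
  have hT0 : 0 < T := by
    refine lt_of_le_of_ne hT.1 ?_
    rintro rfl
    rw [hQ0] at hTθ
    simp [Real.pi_ne_zero] at hTθ
  refine ⟨T, hT0, h.periodic_of_eq hu ?_⟩
  have hexp : Complex.exp (Q T) = (Real.exp (Q T).re : ℂ) := by
    have : Q T = ((Q T).re : ℂ) - 2 * Real.pi * Complex.I := by
      apply Complex.ext
      · simp
      · simp
        linarith
    conv_lhs => rw [this]
    rw [Complex.exp_sub, Complex.exp_two_pi_mul_I, div_one, Complex.ofReal_exp]
  have hray : u T = p + Real.exp (Q T).re • (u 0 - p) := by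
    have := hpolar T
    rw [hexp] at this
    rw [Complex.real_smul, mul_comm, ← this]
    ring
  -- `u T` and `u 0` lie on one ray from `p` and have the same value of `F`.
  have hr : Real.exp (Q T).re = 1 := by
    refine (h.strictMonoOn_ray hw0).injOn (Real.exp_pos _).le (Set.mem_Ici.2 zero_le_one) ?_
    rw [← hray, hc T, one_smul, add_sub_cancel]
  rw [hray, hr, one_smul, add_sub_cancel]

end IsRadial

/-! ### Logarithmic coordinates on the unipotent locus -/

/-- The logarithms of the coordinates on the unipotent locus, as linear functions of
`log σ₁ + i log τ₁`. -/
def weight : Fin 8 → ℂ →L[ℝ] ℝ :=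
  ![Complex.reCLM, -Complex.reCLM, Complex.reCLM, -Complex.reCLM, Complex.reCLM, -Complex.reCLM,
    Complex.imCLM, -Complex.imCLM]

/-- The coordinates of the point of the unipotent locus with given `log σ₁ + i log τ₁`. -/
def leafExp (z : ℂ) (i : Fin 8) : ℝ := Real.exp (weight i z)

lemma leafExp_pos (z : ℂ) (i : Fin 8) : 0 < leafExp z i := Real.exp_pos _

lemma leafExp_eq (z : ℂ) : leafExp z = leafPoint (Real.exp z.re) (Real.exp z.im) := by
  ext i
  fin_cases i <;> simp [leafExp, leafPoint, weight, Real.exp_neg]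

/-- The logarithmic coordinates of a point of the unipotent locus. -/
def toPlane (x : unipotentLocus) : ℂ := ⟨Real.log (σ₁ x.1), Real.log (τ₁ x.1)⟩

lemma leafExp_toPlane (x : unipotentLocus) : leafExp (toPlane x) = coords x.1 := by
  rw [(mem_unipotentLocus_iff x.1).1 x.2, leafExp_eq]
  change leafPoint (Real.exp (Real.log (σ₁ x.1))) (Real.exp (Real.log (τ₁ x.1))) = _
  rw [Real.exp_log (show 0 < σ₁ x.1 from x.1.2 0), Real.exp_log (show 0 < τ₁ x.1 from x.1.2 6)]

/-- The point of the unipotent locus with given logarithmic coordinates. -/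
def ofPlane (z : ℂ) : unipotentLocus :=
  ⟨ofCoords (leafExp_pos z), by
    rw [mem_unipotentLocus_iff]
    change _ = leafPoint (coords _ 0) (coords _ 6)
    rw [coords_ofCoords, leafExp_eq]
    rfl⟩

lemma coords_ofPlane (z : ℂ) : coords (ofPlane z).1 = leafExp z := coords_ofCoords _

lemma σ₁_ofPlane (z : ℂ) : σ₁ (ofPlane z).1 = Real.exp z.re := by
  rw [σ₁, coords_ofPlane]
  rfl

lemma τ₁_ofPlane (z : ℂ) : τ₁ (ofPlane z).1 = Real.exp z.im := by
  rw [τ₁, coords_ofPlane]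
  rfl

lemma toPlane_ofPlane (z : ℂ) : toPlane (ofPlane z) = z := by
  simp [toPlane, σ₁_ofPlane, τ₁_ofPlane]

lemma ofPlane_toPlane (x : unipotentLocus) : ofPlane (toPlane x) = x := by
  apply Subtype.ext
  apply coords_injective
  rw [coords_ofPlane, leafExp_toPlane]

lemma toPlane_injective : Function.Injective toPlane :=
  Function.LeftInverse.injective ofPlane_toPlane

/-! ### Hamiltonian vector fields in logarithmic coordinates -/

lemma hasFDerivAt_leafExp (z : ℂ) :
    HasFDerivAt leafExp (ContinuousLinearMap.pi fun i => leafExp z i • weight i) z :=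
  hasFDerivAt_pi.2 fun i => ((weight i).hasFDerivAt (x := z)).exp

lemma fderiv_comp_leafExp {G : (Fin 8 → ℝ) → ℝ} {z : ℂ} (hG : DifferentiableAt ℝ G (leafExp z))
    (w : ℂ) : fderiv ℝ (fun z => G (leafExp z)) z w =
      ∑ i, leafExp z i * weight i w * fderiv ℝ G (leafExp z) (Pi.single i 1) := by
  have h := (hG.hasFDerivAt.comp z (hasFDerivAt_leafExp z)).fderiv
  change fderiv ℝ (G ∘ leafExp) z w = _
  rw [h, ContinuousLinearMap.comp_apply, ← ContinuousLinearMap.coe_coe,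
    LinearMap.pi_apply_eq_sum_univ]
  refine Finset.sum_congr rfl fun i _ => ?_
  have : (fun j => if i = j then (1 : ℝ) else 0) = Pi.single i 1 := by
    ext j
    simp [Pi.single_apply, eq_comm]
  simp [this]

lemma hamiltonianField_eq (G : (Fin 8 → ℝ) → ℝ) (X : Fin 8 → ℝ) (i : Fin 8) :
    hamiltonianField G X i =
      X i * ∑ j, 2 * ε i j * X j * fderiv ℝ G X (Pi.single j 1) := by
  have h : ∀ a : Fin 8, fderiv ℝ (fun Y : Fin 8 → ℝ => Y i) X (Pi.single a 1) =
      if a = i then 1 else 0 := by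
    intro a
    have : HasFDerivAt (fun Y : Fin 8 → ℝ => Y i)
        (ContinuousLinearMap.proj (R := ℝ) (φ := fun _ : Fin 8 => ℝ) i) X :=
      (ContinuousLinearMap.proj (R := ℝ) (φ := fun _ : Fin 8 => ℝ) i).hasFDerivAt
    rw [this.fderiv]
    simp [Pi.single_apply, eq_comm]
  simp only [hamiltonianField, poissonBracket, h]
  rw [Finset.sum_eq_single i]
  · rw [Finset.mul_sum]
    refine Finset.sum_congr rfl fun j _ => ?_
    rw [if_pos rfl]
    ring
  · intro b _ hb
    simp [hb]
  · simp

/-- If `aᵢ`, `bᵢ` are the real and imaginary coefficients of `weight i`, then `ε i j = aᵢ bⱼ - bᵢ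
aⱼ`. Thus the ambient field is tangent to the leaf and depends only on the restriction of `G` to it.
-/
lemma hamiltonianField_leafExp {G : (Fin 8 → ℝ) → ℝ} {z : ℂ}
    (hG : DifferentiableAt ℝ G (leafExp z)) (i : Fin 8) :
    hamiltonianField G (leafExp z) i =
      leafExp z i * weight i (planarField (fun z => G (leafExp z)) z) := by
  rw [hamiltonianField_eq]
  congr 1
  have h1 := fderiv_comp_leafExp hG 1
  have hI := fderiv_comp_leafExp hG Complex.I
  have hre := planarField_re (fun z => G (leafExp z)) z
  have him := planarField_im (fun z => G (leafExp z)) z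
  rw [hI] at hre
  rw [h1] at him
  generalize planarField (fun z => G (leafExp z)) z = v at hre him
  generalize leafExp z = X at hre him
  generalize fderiv ℝ G X = g at hre him
  simp only [Fin.sum_univ_eight] at hre him ⊢
  fin_cases i <;> simp [weight, ε, hre, him] at hre him ⊢ <;> ring

/-- Coordinates `0` and `6` are the exponentials of the real and imaginary parts, so they already
recover `u`. -/
lemma hasDerivAt_iff_leafExp {u : ℝ → ℂ} {v : ℂ} {t : ℝ} :
    (∀ i, HasDerivAt (fun s => leafExp (u s) i) (leafExp (u t) i * weight i v) t) ↔
      HasDerivAt u v t := by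
  constructor
  · intro h
    have hlog : ∀ i, HasDerivAt (fun s => weight i (u s)) (weight i v) t := by
      intro i
      have := (h i).log (leafExp_pos (u t) i).ne'
      rw [mul_div_cancel_left₀ _ (leafExp_pos (u t) i).ne'] at this
      simpa only [leafExp, Real.log_exp] using this
    have hre : HasDerivAt (fun s => (u s).re) v.re t := hlog 0
    have him : HasDerivAt (fun s => (u s).im) v.im t := hlog 6
    have := hre.ofReal_comp.add (him.ofReal_comp.mul_const Complex.I)
    refine (this.congr_deriv (Complex.re_add_im v)).congr_of_eventuallyEq ?_
    exact Filter.Eventually.of_forall fun s => (Complex.re_add_im (u s)).symm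
  · intro h i
    exact (((weight i).hasFDerivAt (x := u t)).comp_hasDerivAt t h).exp

/-! ### Hamiltonian flows on the unipotent locus -/

lemma inCoords_coords (f : PosModuli → ℝ) (x : PosModuli) : inCoords f (coords x) = f x :=
  coords_injective.extend_apply f 0 x

lemma isOpen_orthant : IsOpen orthant := by
  have : orthant = ⋂ i, {X : Fin 8 → ℝ | 0 < X i} := by
    ext X
    simp [orthant]
  rw [this]
  exact isOpen_iInter_of_finite fun i => isOpen_lt continuous_const (continuous_apply i)

lemma isHamiltonianFlow_iff {f : PosModuli → ℝ} (hf : ContDiffOn ℝ ∞ (inCoords f) orthant)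
    {Φ : ℝ → unipotentLocus → unipotentLocus} : IsHamiltonianFlow f Φ ↔ (∀ x, Φ 0 x = x) ∧
      ∀ x t, HasDerivAt (fun s => toPlane (Φ s x))
        (planarField (fun z => f (ofPlane z).1) (toPlane (Φ t x))) t := by
  have e : (fun z => f (ofPlane z).1) = fun z => inCoords f (leafExp z) := by
    ext z
    rw [← coords_ofPlane, inCoords_coords]
  have hd : ∀ z, DifferentiableAt ℝ (inCoords f) (leafExp z) := fun z =>
    (hf.contDiffAt (isOpen_orthant.mem_nhds (leafExp_pos z))).differentiableAt (by simp)
  rw [e, IsHamiltonianFlow]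
  refine and_congr_right fun _ => forall_congr' fun x => forall_congr' fun t => ?_
  rw [← hasDerivAt_iff_leafExp]
  refine forall_congr' fun i => ?_
  rw [← hamiltonianField_leafExp (hd _)]
  simp only [leafExp_toPlane]

/-- The dynamics of a Hamiltonian flow on the unipotent locus whose Hamiltonian has bounded
sublevel sets and increases along the rays from a point in logarithmic coordinates. -/
lemma exists_center {f : PosModuli → ℝ} (hf : ContDiffOn ℝ ∞ (inCoords f) orthant) {p : ℂ}
    (h : IsRadial (fun z => f (ofPlane z).1) p) :
    ∃ P : unipotentLocus, σ₁ P.1 = Real.exp p.re ∧ τ₁ P.1 = Real.exp p.im ∧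
      (∀ q : unipotentLocus, q ≠ P → f P.1 < f q.1) ∧ (∃! Φ, IsHamiltonianFlow f Φ) ∧
        ∀ Φ, IsHamiltonianFlow f Φ → (∀ x, ∃ T > 0, Function.Periodic (fun t => Φ t x) T) ∧
          ∀ x, (∀ t, Φ t x = x) ↔ x = P := by
  refine ⟨ofPlane p, σ₁_ofPlane p, τ₁_ofPlane p, fun q hq => ?_, ?_, fun Φ hΦ => ⟨fun x => ?_,
    fun x => ?_⟩⟩
  · have hne : toPlane q ≠ p := by
      rintro rfl
      exact hq (ofPlane_toPlane q).symm
    simpa only [ofPlane_toPlane] using h.lt hne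
  · choose u hu0 hu using h.exists_solution
    refine ⟨fun t x => ofPlane (u (toPlane x) t), (isHamiltonianFlow_iff hf).2
      ⟨fun x => by rw [hu0, ofPlane_toPlane], fun x t => ?_⟩, fun Ψ hΨ => ?_⟩
    · simp only [toPlane_ofPlane]
      exact hu _ _
    · obtain ⟨h0, hd⟩ := (isHamiltonianFlow_iff hf).1 hΨ
      ext1 t
      ext1 x
      have := h.solution_unique (hd x) (hu (toPlane x)) (by rw [h0, hu0])
      rw [← congrFun this t, ofPlane_toPlane]
  · obtain ⟨h0, hd⟩ := (isHamiltonianFlow_iff hf).1 hΦ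
    obtain ⟨T, hT, hper⟩ := h.exists_period (hd x)
    exact ⟨T, hT, fun t => toPlane_injective (hper t)⟩
  · obtain ⟨h0, hd⟩ := (isHamiltonianFlow_iff hf).1 hΦ
    constructor
    · intro hfix
      have h1 := hd x 0
      simp only [hfix] at h1
      have h2 := (h.planarField_eq_zero_iff _).1 (h1.unique (hasDerivAt_const 0 _))
      rw [← h2, ofPlane_toPlane]
    · rintro rfl t
      have hconst : ∀ t : ℝ, HasDerivAt (fun _ : ℝ => p)
          (planarField (fun z => f (ofPlane z).1) p) t := fun t => by
        rw [(h.planarField_eq_zero_iff p).2 rfl]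
        exact hasDerivAt_const t p
      have := h.solution_unique (hd (ofPlane p)) hconst (by rw [h0, toPlane_ofPlane])
      apply toPlane_injective
      rw [congrFun this t, toPlane_ofPlane]

/-! ### Positive sums of exponentials -/

lemma hasFDerivAt_sum_exp {ι : Type*} [Fintype ι] (C : ℝ) (c : ι → ℝ) (l : ι → ℂ →L[ℝ] ℝ)
    (z : ℂ) : HasFDerivAt (fun z => C + ∑ i, c i * Real.exp (l i z))
      (∑ i, c i • Real.exp (l i z) • l i) z := by
  refine HasFDerivAt.const_add C (HasFDerivAt.fun_sum fun i _ => ?_)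
  exact (((l i).hasFDerivAt (x := z)).exp).const_mul (c i)

lemma mul_exp_sub_exp_nonneg (a b : ℝ) : 0 ≤ (a - b) * (Real.exp a - Real.exp b) := by
  rcases le_total a b with h | h
  · exact mul_nonneg_of_nonpos_of_nonpos (sub_nonpos.2 h) (sub_nonpos.2 (Real.exp_le_exp.2 h))
  · exact mul_nonneg (sub_nonneg.2 h) (sub_nonneg.2 (Real.exp_le_exp.2 h))

lemma mul_exp_sub_exp_pos {a b : ℝ} (h : b < a) : 0 < (a - b) * (Real.exp a - Real.exp b) :=
  mul_pos (sub_pos.2 h) (sub_pos.2 (Real.exp_lt_exp.2 h))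

/-- A positive sum of exponentials whose exponents span the plane positively is proper, and it
increases along the rays from a critical point. -/
lemma isRadial_sum_exp {ι : Type*} [Fintype ι] {C : ℝ} {c : ι → ℝ} {l : ι → ℂ →L[ℝ] ℝ} {p : ℂ}
    (hc : ∀ i, 0 < c i) (hl : ∀ w : ℂ, ∃ i, ‖w‖ ≤ l i w)
    (hcrit : ∀ w, ∑ i, c i * Real.exp (l i p) * l i w = 0) :
    IsRadial (fun z => C + ∑ i, c i * Real.exp (l i z)) p where
  smooth := contDiff_const.add
    (ContDiff.sum fun i _ => contDiff_const.mul (Real.contDiff_exp.comp (l i).contDiff))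
  bounded M := by
    -- The radius is a sum over all `j` because the form that dominates the norm depends on `z`.
    refine (Metric.isBounded_closedBall (x := (0 : ℂ)) (r := ∑ j, |M - C| / c j)).subset ?_
    intro z hz
    obtain ⟨i, hi⟩ := hl z
    have h1 : c i * Real.exp (l i z) ≤ ∑ j, c j * Real.exp (l j z) :=
      Finset.single_le_sum (f := fun j => c j * Real.exp (l j z))
        (fun j _ => (mul_pos (hc j) (Real.exp_pos _)).le) (Finset.mem_univ i)
    have h2 : C + ∑ j, c j * Real.exp (l j z) ≤ M := hz
    have h3 : c i * Real.exp (l i z) ≤ |M - C| := by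
      linarith [le_abs_self (M - C)]
    have h4 : |M - C| / c i ≤ ∑ j, |M - C| / c j :=
      Finset.single_le_sum (f := fun j => |M - C| / c j)
        (fun j _ => div_nonneg (abs_nonneg _) (hc j).le) (Finset.mem_univ i)
    rw [mem_closedBall_zero_iff]
    calc ‖z‖ ≤ l i z := hi
      _ ≤ Real.exp (l i z) := by linarith [Real.add_one_le_exp (l i z)]
      _ ≤ |M - C| / c i := by rw [le_div_iff₀ (hc i)]; linarith
      _ ≤ _ := h4
  radial z hz := by
    rw [(hasFDerivAt_sum_exp C c l z).fderiv]
    -- Subtracting the vanishing derivative at `p` leaves terms `(a - b) (exp a - exp b) ≥ 0`; the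
    -- form dominating the norm of `z - p` makes one of them positive.
    have h1 : (∑ i, c i • Real.exp (l i z) • l i) (z - p) =
        ∑ i, c i * ((l i z - l i p) * (Real.exp (l i z) - Real.exp (l i p))) := by
      rw [← sub_zero ((∑ i, c i • Real.exp (l i z) • l i) (z - p)), ← hcrit (z - p),
        sum_apply, ← Finset.sum_sub_distrib]
      refine Finset.sum_congr rfl fun i _ => ?_
      simp only [smul_apply, smul_eq_mul, map_sub]
      ring
    rw [h1]
    obtain ⟨i, hi⟩ := hl (z - p)
    rw [map_sub] at hi
    refine Finset.sum_pos' (fun j _ => mul_nonneg (hc j).le (mul_exp_sub_exp_nonneg _ _))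
      ⟨i, Finset.mem_univ i, mul_pos (hc i) (mul_exp_sub_exp_pos ?_)⟩
    linarith [norm_pos_iff.2 (sub_ne_zero.2 hz)]

/-- The exponent of the monomial `σ₁ ^ a * τ₁ ^ b` in logarithmic coordinates. -/
def monomialExponent (a b : ℝ) : ℂ →L[ℝ] ℝ := a • Complex.reCLM + b • Complex.imCLM

lemma monomialExponent_apply (a b : ℝ) (z : ℂ) :
    monomialExponent a b z = a * z.re + b * z.im := rfl

lemma exp_monomialExponent (j k m n : ℕ) (z : ℂ) :
    Real.exp (monomialExponent ((j : ℝ) - m) ((k : ℝ) - n) z) =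
      Real.exp z.re ^ j * Real.exp z.im ^ k / (Real.exp z.re ^ m * Real.exp z.im ^ n) := by
  rw [monomialExponent_apply, ← Real.exp_nat_mul, ← Real.exp_nat_mul, ← Real.exp_nat_mul,
    ← Real.exp_nat_mul, ← Real.exp_add, ← Real.exp_add, ← Real.exp_sub]
  congr 1
  ring

/-- In the quadrant of `w`, the corner with matching signs gives at least `|re w| + |im w|`. It is
applied to the corners of the rectangle of exponents of a trace. -/
lemma exists_norm_le_monomialExponent {a₁ a₂ b₁ b₂ : ℝ} (ha₁ : a₁ ≤ -1) (ha₂ : 1 ≤ a₂)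
    (hb₁ : b₁ ≤ -1) (hb₂ : 1 ≤ b₂) (w : ℂ) : ‖w‖ ≤ monomialExponent a₁ b₁ w ∨
      ‖w‖ ≤ monomialExponent a₁ b₂ w ∨ ‖w‖ ≤ monomialExponent a₂ b₁ w ∨
        ‖w‖ ≤ monomialExponent a₂ b₂ w := by
  have h := Complex.norm_le_abs_re_add_abs_im w
  simp only [monomialExponent_apply]
  rcases le_total 0 w.re with h1 | h1 <;> rcases le_total 0 w.im with h2 | h2
  · rw [abs_of_nonneg h1, abs_of_nonneg h2] at h
    exact Or.inr (Or.inr (Or.inr (by nlinarith)))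
  · rw [abs_of_nonneg h1, abs_of_nonpos h2] at h
    exact Or.inr (Or.inr (Or.inl (by nlinarith)))
  · rw [abs_of_nonpos h1, abs_of_nonneg h2] at h
    exact Or.inr (Or.inl (by nlinarith))
  · rw [abs_of_nonpos h1, abs_of_nonpos h2] at h
    exact Or.inl (by nlinarith)

/-! ### The holonomy on the unipotent locus -/

lemma cbrt_one_div {x : ℝ} (hx : 0 < x) : (1 / x) ^ (1 / 3 : ℝ) = 1 / x ^ (1 / 3 : ℝ) := by
  rw [Real.div_rpow zero_le_one hx.le, Real.one_rpow]

/-- On the leaf the scalar prefactors multiply to one, so the cube roots disappear and the entries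
are Laurent polynomials. -/
lemma matE_matT_leaf {x y : ℝ} (hx : 0 < x) (hy : 0 < y) :
    matE (1 / x) x * matT (1 / y) * matE x (1 / x) * matT y =
      !![1, (1 + x) * (1 + 1 / y), (1 + x) * (1 + 1 / y); 0, 1, 1 + 1 / x; 0, 0, 1] := by
  have h1 : x ^ (1 / 3 : ℝ) ≠ 0 := (Real.rpow_pos_of_pos hx _).ne'
  have h2 : y ^ (1 / 3 : ℝ) ≠ 0 := (Real.rpow_pos_of_pos hy _).ne'
  have hxx := hx.ne'
  have hyy := hy.ne'
  rw [mul_assoc, matE_mul_matT, matE_mul_matT, smul_mul_smul_comm, cbrt_one_div hx,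
    cbrt_one_div hy]
  generalize x ^ (1 / 3 : ℝ) = r at h1
  generalize y ^ (1 / 3 : ℝ) = s at h2
  have e : 1 / r / r * (1 / (1 / s)) * (r / (1 / r) * (1 / s)) = 1 := by field_simp
  rw [e, one_smul]
  ext i j
  fin_cases i <;> fin_cases j <;> simp <;> field_simp <;> ring

lemma matT_matE_leaf {x y : ℝ} (hx : 0 < x) (hy : 0 < y) :
    matT y * matE (1 / x) x * matT (1 / y) * matE x (1 / x) =
      !![1, 0, 0; -(1 + 1 / x), 1, 0; (1 + 1 / x) * (1 + y), -((1 + x) * (1 + y)), 1] := by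
  have h1 : x ^ (1 / 3 : ℝ) ≠ 0 := (Real.rpow_pos_of_pos hx _).ne'
  have h2 : y ^ (1 / 3 : ℝ) ≠ 0 := (Real.rpow_pos_of_pos hy _).ne'
  have hxx := hx.ne'
  have hyy := hy.ne'
  simp only [matT, matE, smul_mul_smul_comm, cbrt_one_div hx, cbrt_one_div hy]
  generalize x ^ (1 / 3 : ℝ) = r at h1
  generalize y ^ (1 / 3 : ℝ) = s at h2
  have e : 1 / s * (1 / r / r) * (1 / (1 / s)) * (r / (1 / r)) = 1 := by field_simp
  rw [e, one_smul]
  ext i j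
  fin_cases i <;> fin_cases j <;> simp <;> field_simp <;> ring

lemma tr_eq (x : PosModuli) (c : Pi1) : tr c x = (homOf (holA x.2) (holC x.2) c).1.trace := by
  exact congrArg (Moduli.tr c) (mk_stdRep x).symm

lemma holA_leaf (z : ℂ) : (holA (ofPlane z).1.2).1 =
    !![1, (1 + Real.exp z.re) * (1 + 1 / Real.exp z.im),
      (1 + Real.exp z.re) * (1 + 1 / Real.exp z.im); 0, 1, 1 + 1 / Real.exp z.re; 0, 0, 1] := by
  have h : coords (ofPlane z).1 = leafPoint (Real.exp z.re) (Real.exp z.im) := by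
    rw [coords_ofPlane, leafExp_eq]
  change matE (coords _ 1) (coords _ 0) * matT (coords _ 7) * matE (coords _ 2) (coords _ 3) *
    matT (coords _ 6) = _
  rw [h]
  exact matE_matT_leaf (Real.exp_pos _) (Real.exp_pos _)

lemma holC_leaf (z : ℂ) : (holC (ofPlane z).1.2).1 =
    !![1, 0, 0; -(1 + 1 / Real.exp z.re), 1, 0; (1 + 1 / Real.exp z.re) * (1 + Real.exp z.im),
      -((1 + Real.exp z.re) * (1 + Real.exp z.im)), 1] := by
  have h : coords (ofPlane z).1 = leafPoint (Real.exp z.re) (Real.exp z.im) := by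
    rw [coords_ofPlane, leafExp_eq]
  change matT (coords _ 6) * matE (coords _ 5) (coords _ 4) * matT (coords _ 7) *
    matE (coords _ 0) (coords _ 1) = _
  rw [h]
  exact matT_matE_leaf (Real.exp_pos _) (Real.exp_pos _)

lemma coe_inv_of_mul_eq_one {g : SL(3, ℝ)} {M N : Matrix (Fin 3) (Fin 3) ℝ} (hg : g.1 = M)
    (h : M * N = 1) : (g⁻¹).1 = N := by
  have : (g⁻¹).1 * (g.1 * N) = N := by
    rw [← mul_assoc, ← Matrix.SpecialLinearGroup.coe_mul, inv_mul_cancel,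
      Matrix.SpecialLinearGroup.coe_one, one_mul]
  rw [← this, hg, h, mul_one]

lemma upper_mul_inv (u v w : ℝ) :
    !![1, u, v; 0, 1, w; 0, 0, 1] * !![1, -u, u * w - v; 0, 1, -w; 0, 0, 1] = 1 := by
  ext i j
  fin_cases i <;> fin_cases j <;> simp

lemma lower_mul_inv (u v w : ℝ) :
    !![1, 0, 0; u, 1, 0; v, w, 1] * !![1, 0, 0; -u, 1, 0; u * w - v, -w, 1] = 1 := by
  ext i j
  fin_cases i <;> fin_cases j <;> simp
  ring

/-- Binomial expansion of `(1 + N) ^ k` with `N ^ 3 = 0`. -/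
lemma upper_pow (u v w : ℝ) (k : ℕ) : !![1, u, v; 0, 1, w; 0, 0, 1] ^ k =
    !![1, k * u, k * v + k * (k - 1) / 2 * (u * w); 0, 1, k * w; 0, 0, 1] := by
  induction k with
  | zero =>
    ext i j
    fin_cases i <;> fin_cases j <;> simp
  | succ k ih =>
    rw [pow_succ, ih]
    ext i j
    fin_cases i <;> fin_cases j <;> simp <;> ring

/-! ### The curves `α ^ k * γ⁻¹` -/

/-- The exponent `k` enters only through the factor `k (k + 1) / 2`, so the minimum point does not
depend on it. -/
lemma tr_pow_ofPlane (k : ℕ) (z : ℂ) : tr (α ^ k * γ⁻¹) (ofPlane z).1 =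
    3 + k * (k + 1) / 2 * ((1 + Real.exp z.re) ^ 3 / Real.exp z.re *
      ((1 + Real.exp z.im) ^ 2 / Real.exp z.im)) := by
  have hx := (Real.exp_pos z.re).ne'
  have hy := (Real.exp_pos z.im).ne'
  rw [tr_eq, map_mul, map_pow, map_inv, homOf_α, homOf_γ, Matrix.SpecialLinearGroup.coe_mul,
    Matrix.SpecialLinearGroup.coe_pow, holA_leaf,
    coe_inv_of_mul_eq_one (holC_leaf z) (lower_mul_inv _ _ _), upper_pow]
  simp [Matrix.trace, Fin.sum_univ_three]
  field_simp
  ring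

/-- The coefficients of `tr (α ^ k * γ⁻¹) - 3` on the unipotent locus. -/
def powCoeff (k : ℕ) (i : Fin 4 × Fin 3) : ℝ :=
  k * (k + 1) / 2 * (![1, 3, 3, 1] i.1 * ![1, 2, 1] i.2)

lemma isRadial_tr_pow {k : ℕ} (hk : 1 ≤ k) :
    IsRadial (fun z => tr (α ^ k * γ⁻¹) (ofPlane z).1) ⟨Real.log (1 / 2), 0⟩ := by
  have hk' : (0 : ℝ) < k * (k + 1) / 2 := by positivity
  have e : (fun z => tr (α ^ k * γ⁻¹) (ofPlane z).1) = fun z => 3 + ∑ i : Fin 4 × Fin 3,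
      powCoeff k i * Real.exp (monomialExponent ((i.1 : ℕ) - (1 : ℕ)) ((i.2 : ℕ) - (1 : ℕ)) z) := by
    ext z
    have hx := (Real.exp_pos z.re).ne'
    have hy := (Real.exp_pos z.im).ne'
    rw [tr_pow_ofPlane]
    simp only [exp_monomialExponent, Fintype.sum_prod_type, Fin.sum_univ_four, Fin.sum_univ_three,
      powCoeff]
    simp
    field_simp
    ring
  rw [e]
  refine isRadial_sum_exp ?_ ?_ ?_
  · rintro ⟨i, j⟩
    refine mul_pos hk' (mul_pos ?_ ?_)
    · fin_cases i <;> simp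
    · fin_cases j <;> simp
  · intro w
    rcases exists_norm_le_monomialExponent (a₁ := (0 : ℕ) - (1 : ℕ)) (a₂ := (3 : ℕ) - (1 : ℕ))
      (b₁ := (0 : ℕ) - (1 : ℕ)) (b₂ := (2 : ℕ) - (1 : ℕ)) (by norm_num) (by norm_num)
      (by norm_num) (by norm_num) w with h | h | h | h
    · exact ⟨(0, 0), h⟩
    · exact ⟨(0, 2), h⟩
    · exact ⟨(3, 0), h⟩
    · exact ⟨(3, 2), h⟩
  · intro w
    simp only [exp_monomialExponent]
    simp only [Fintype.sum_prod_type, Fin.sum_univ_four, Fin.sum_univ_three, powCoeff,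
      monomialExponent_apply]
    -- The factors `(1 + x)³ / x` and `(1 + y)² / y` are critical at `x = 1/2` and `y = 1`.
    rw [Real.exp_log (by norm_num), Real.exp_zero]
    simp
    ring

/-! ### The commutator -/

lemma tr_commutator_ofPlane (z : ℂ) : tr (α * γ * α⁻¹ * γ⁻¹) (ofPlane z).1 =
    (fun x y : ℝ => ((1 + 3 * x + 3 * x ^ 2 + 2 * x ^ 3 + 3 * x ^ 4 + 3 * x ^ 5 + x ^ 6) +
      (3 + 12 * x + 21 * x ^ 2 + 27 * x ^ 3 + 21 * x ^ 4 + 12 * x ^ 5 + 3 * x ^ 6) * y +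
      (3 + 15 * x + 33 * x ^ 2 + 42 * x ^ 3 + 33 * x ^ 4 + 15 * x ^ 5 + 3 * x ^ 6) * y ^ 2 +
      (1 + 6 * x + 15 * x ^ 2 + 20 * x ^ 3 + 15 * x ^ 4 + 6 * x ^ 5 + x ^ 6) * y ^ 3) /
        (x ^ 3 * y)) (Real.exp z.re) (Real.exp z.im) := by
  have hx := (Real.exp_pos z.re).ne'
  have hy := (Real.exp_pos z.im).ne'
  rw [tr_eq]
  simp only [map_mul, map_inv, homOf_α, homOf_γ, Matrix.SpecialLinearGroup.coe_mul]
  rw [holA_leaf, holC_leaf, coe_inv_of_mul_eq_one (holA_leaf z) (upper_mul_inv _ _ _),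
    coe_inv_of_mul_eq_one (holC_leaf z) (lower_mul_inv _ _ _)]
  generalize Real.exp z.re = x at hx
  generalize Real.exp z.im = y at hy
  simp [Matrix.trace, Fin.sum_univ_three]
  field_simp
  ring

/-- The coefficients of the trace of the commutator on the unipotent locus. -/
def commutatorCoeff (i : Fin 7 × Fin 4) : ℝ :=
  (![![1, 3, 3, 1], ![3, 12, 15, 6], ![3, 21, 33, 15], ![2, 27, 42, 20], ![3, 21, 33, 15],
    ![3, 12, 15, 6], ![1, 3, 3, 1]] : Fin 7 → Fin 4 → ℝ) i.1 i.2

lemma isRadial_tr_commutator : IsRadial (fun z => tr (α * γ * α⁻¹ * γ⁻¹) (ofPlane z).1)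
    ⟨0, Real.log ((Real.sqrt 33 - 1) / 16)⟩ := by
  have e : (fun z => tr (α * γ * α⁻¹ * γ⁻¹) (ofPlane z).1) = fun z => 0 + ∑ i : Fin 7 × Fin 4,
      commutatorCoeff i *
        Real.exp (monomialExponent ((i.1 : ℕ) - (3 : ℕ)) ((i.2 : ℕ) - (1 : ℕ)) z) := by
    ext z
    have hx := (Real.exp_pos z.re).ne'
    have hy := (Real.exp_pos z.im).ne'
    rw [tr_commutator_ofPlane]
    simp only [exp_monomialExponent, Fintype.sum_prod_type, Fin.sum_univ_seven, Fin.sum_univ_four,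
      commutatorCoeff]
    generalize Real.exp z.re = x at hx
    generalize Real.exp z.im = y at hy
    simp
    field_simp
    ring
  rw [e]
  refine isRadial_sum_exp ?_ ?_ ?_
  · rintro ⟨i, j⟩
    fin_cases i <;> fin_cases j <;> simp [commutatorCoeff]
  · intro w
    rcases exists_norm_le_monomialExponent (a₁ := (0 : ℕ) - (3 : ℕ)) (a₂ := (6 : ℕ) - (3 : ℕ))
      (b₁ := (0 : ℕ) - (1 : ℕ)) (b₂ := (3 : ℕ) - (1 : ℕ)) (by norm_num) (by norm_num)
      (by norm_num) (by norm_num) w with h | h | h | h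
    · exact ⟨(0, 0), h⟩
    · exact ⟨(0, 3), h⟩
    · exact ⟨(6, 0), h⟩
    · exact ⟨(6, 3), h⟩
  · intro w
    have h33 : Real.sqrt 33 ^ 2 = 33 := Real.sq_sqrt (by norm_num)
    have hpos : 0 < (Real.sqrt 33 - 1) / 16 := by
      have : 1 < Real.sqrt 33 := by
        rw [Real.lt_sqrt zero_le_one]
        norm_num
      linarith
    have hroot : 8 * ((Real.sqrt 33 - 1) / 16) ^ 2 + (Real.sqrt 33 - 1) / 16 - 1 = 0 := by
      linear_combination h33 / 32
    simp only [exp_monomialExponent]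
    simp only [Fintype.sum_prod_type, Fin.sum_univ_seven, Fin.sum_univ_four, commutatorCoeff,
      monomialExponent_apply]
    rw [Real.exp_log hpos, Real.exp_zero]
    generalize (Real.sqrt 33 - 1) / 16 = y at hpos hroot
    have hy := hpos.ne'
    -- The coefficients are palindromic in `x`, so at `x = 1` the `re` part cancels. The column sums
    -- `16, 99, 144, 64` give `16/y + 99 + 144 y + 64 y²`, whose logarithmic derivative `y d/dy` is
    -- the displayed factor.
    refine Eq.trans ?_ (show w.im * (16 * (y + 1) * (8 * y ^ 2 + y - 1)) / y = 0 by
      rw [hroot]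
      simp)
    simp
    field_simp
    ring

/-! ### Smoothness of the trace functions -/

/-- The entries of a matrix depend smoothly on the coordinates. -/
def SmoothEntries (M : (Fin 8 → ℝ) → Matrix (Fin 3) (Fin 3) ℝ) : Prop :=
  ∀ i j, ContDiffOn ℝ ∞ (fun X => M X i j) orthant

namespace SmoothEntries

variable {M N : (Fin 8 → ℝ) → Matrix (Fin 3) (Fin 3) ℝ}

lemma mul (hM : SmoothEntries M) (hN : SmoothEntries N) : SmoothEntries fun X => M X * N X :=
  fun i j => by
    simp only [Matrix.mul_apply]
    exact ContDiffOn.sum fun k _ => (hM i k).mul (hN k j)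

lemma pow (hM : SmoothEntries M) (k : ℕ) : SmoothEntries fun X => M X ^ k := by
  induction k with
  | zero =>
    intro i j
    simp only [pow_zero]
    exact contDiffOn_const
  | succ k ih =>
    simp only [pow_succ]
    exact ih.mul hM

/-- In `SL(3, ℝ)` the inverse is the adjugate, hence polynomial in the entries. -/
lemma adjugate (hM : SmoothEntries M) : SmoothEntries fun X => (M X).adjugate := by
  intro i j
  simp only [Matrix.adjugate_fin_three]
  fin_cases i <;> fin_cases j <;> simp <;>
    first
    | exact ((hM _ _).mul (hM _ _)).sub ((hM _ _).mul (hM _ _))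
    | exact ((hM _ _).mul (hM _ _)).neg.add ((hM _ _).mul (hM _ _))

lemma trace (hM : SmoothEntries M) : ContDiffOn ℝ ∞ (fun X => (M X).trace) orthant := by
  simp only [Matrix.trace, Matrix.diag]
  exact ContDiffOn.sum fun i _ => hM i i

lemma contDiffOn_cbrt (i : Fin 8) :
    ContDiffOn ℝ ∞ (fun X : Fin 8 → ℝ => X i ^ (1 / 3 : ℝ)) orthant :=
  (contDiff_apply ℝ ℝ i).contDiffOn.rpow_const_of_ne fun _ hX => (hX i).ne'

lemma matT (i : Fin 8) : SmoothEntries fun X => Pants.matT (X i) := by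
  have h1 : ContDiffOn ℝ ∞ (fun X : Fin 8 → ℝ => 1 / X i ^ (1 / 3 : ℝ)) orthant :=
    contDiffOn_const.div (contDiffOn_cbrt i) fun X hX => (Real.rpow_pos_of_pos (hX i) _).ne'
  have h2 : ContDiffOn ℝ ∞ (fun X : Fin 8 → ℝ => X i) orthant := (contDiff_apply ℝ ℝ i).contDiffOn
  intro a b
  simp only [Pants.matT, Matrix.smul_apply, smul_eq_mul]
  refine h1.mul ?_
  fin_cases a <;> fin_cases b <;> first | exact contDiffOn_const | exact h2 |
    exact contDiffOn_const.add h2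

lemma matE (i j : Fin 8) : SmoothEntries fun X => Pants.matE (X i) (X j) := by
  have h1 : ContDiffOn ℝ ∞ (fun X : Fin 8 → ℝ => X i ^ (1 / 3 : ℝ) / X j ^ (1 / 3 : ℝ))
      orthant :=
    (contDiffOn_cbrt i).div (contDiffOn_cbrt j) fun X hX => (Real.rpow_pos_of_pos (hX j) _).ne'
  have h2 : ContDiffOn ℝ ∞ (fun X : Fin 8 → ℝ => X j) orthant := (contDiff_apply ℝ ℝ j).contDiffOn
  have h3 : ContDiffOn ℝ ∞ (fun X : Fin 8 → ℝ => 1 / X i) orthant :=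
    contDiffOn_const.div (contDiff_apply ℝ ℝ i).contDiffOn fun X hX => (hX i).ne'
  intro a b
  simp only [Pants.matE, Matrix.smul_apply, smul_eq_mul]
  refine h1.mul ?_
  fin_cases a <;> fin_cases b <;> first | exact contDiffOn_const | exact h2 | exact h3

end SmoothEntries

/-- The holonomy of `α` as a function of the coordinates. -/
def matA (X : Fin 8 → ℝ) : Matrix (Fin 3) (Fin 3) ℝ :=
  matE (X 1) (X 0) * matT (X 7) * matE (X 2) (X 3) * matT (X 6)

/-- The holonomy of `γ` as a function of the coordinates. -/
def matC (X : Fin 8 → ℝ) : Matrix (Fin 3) (Fin 3) ℝ :=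
  matT (X 6) * matE (X 5) (X 4) * matT (X 7) * matE (X 0) (X 1)

lemma smoothEntries_matA : SmoothEntries matA :=
  (((SmoothEntries.matE 1 0).mul (SmoothEntries.matT 7)).mul (SmoothEntries.matE 2 3)).mul
    (SmoothEntries.matT 6)

lemma smoothEntries_matC : SmoothEntries matC :=
  (((SmoothEntries.matT 6).mul (SmoothEntries.matE 5 4)).mul (SmoothEntries.matT 7)).mul
    (SmoothEntries.matE 0 1)

/-- On the orthant, which is the image of the coordinates, `inCoords` is the trace of an explicit
matrix; its extension by zero plays no role. -/
lemma contDiffOn_inCoords_tr {c : Pi1} {M : (Fin 8 → ℝ) → Matrix (Fin 3) (Fin 3) ℝ}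
    (hM : SmoothEntries M)
    (h : ∀ (X : Fin 8 → ℝ) (hX : ∀ i, 0 < X i), (homOf (holA hX) (holC hX) c).1 = M X) :
    ContDiffOn ℝ ∞ (inCoords (tr c)) orthant := by
  refine hM.trace.congr fun X hX => ?_
  obtain ⟨x, rfl⟩ : X ∈ Set.range coords := range_coords ▸ hX
  rw [inCoords_coords, tr_eq]
  exact congrArg Matrix.trace (h _ x.2)

lemma contDiffOn_tr_pow (k : ℕ) : ContDiffOn ℝ ∞ (inCoords (tr (α ^ k * γ⁻¹))) orthant := by
  refine contDiffOn_inCoords_tr ((smoothEntries_matA.pow k).mul smoothEntries_matC.adjugate)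
    fun X hX => ?_
  rw [map_mul, map_pow, map_inv, homOf_α, homOf_γ, Matrix.SpecialLinearGroup.coe_mul,
    Matrix.SpecialLinearGroup.coe_pow, Matrix.SpecialLinearGroup.coe_inv]
  rfl

lemma contDiffOn_tr_commutator :
    ContDiffOn ℝ ∞ (inCoords (tr (α * γ * α⁻¹ * γ⁻¹))) orthant := by
  refine contDiffOn_inCoords_tr (((smoothEntries_matA.mul smoothEntries_matC).mul
    smoothEntries_matA.adjugate).mul smoothEntries_matC.adjugate) fun X hX => ?_
  simp only [map_mul, map_inv, homOf_α, homOf_γ, Matrix.SpecialLinearGroup.coe_mul,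
    Matrix.SpecialLinearGroup.coe_inv]
  rfl

end Pants

end

open Pants in
theorem theoremE :
    -- the coordinates identify the space of positive framed representations with the open
    -- orthant, and the holonomy is given by the reconstruction matrices
    (Function.Injective coords ∧ Set.range coords = orthant ∧
      ∀ x : PosModuli, ∃ R : FramedRep, (⟦R⟧ : Moduli) = x.1 ∧
        (R.hol α).1 = matE (coords x 1) (coords x 0) * matT (coords x 7) *
          matE (coords x 2) (coords x 3) * matT (coords x 6) ∧
        (R.hol γ).1 = matT (coords x 6) * matE (coords x 5) (coords x 4) *
          matT (coords x 7) * matE (coords x 0) (coords x 1)) ∧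
    -- the unipotent locus in coordinates
    (∀ x : PosModuli, x ∈ unipotentLocus ↔
      coords x = ![σ₁ x, 1 / σ₁ x, σ₁ x, 1 / σ₁ x, σ₁ x, 1 / σ₁ x, τ₁ x, 1 / τ₁ x]) ∧
    -- the commutator
    (ContDiffOn ℝ ∞ (inCoords (tr (α * γ * α⁻¹ * γ⁻¹))) orthant ∧
      ∃ p : unipotentLocus, σ₁ p.1 = 1 ∧ τ₁ p.1 = (Real.sqrt 33 - 1) / 16 ∧
        (∀ q : unipotentLocus, q ≠ p →
          tr (α * γ * α⁻¹ * γ⁻¹) p.1 < tr (α * γ * α⁻¹ * γ⁻¹) q.1) ∧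
        (∃! Φ, IsHamiltonianFlow (tr (α * γ * α⁻¹ * γ⁻¹)) Φ) ∧
        ∀ Φ, IsHamiltonianFlow (tr (α * γ * α⁻¹ * γ⁻¹)) Φ →
          (∀ x, ∃ T > 0, Function.Periodic (fun t => Φ t x) T) ∧
          ∀ x, (∀ t, Φ t x = x) ↔ x = p) ∧
    -- the curves going `k` times around a boundary component
    (∀ k : ℕ, 1 ≤ k →
      ContDiffOn ℝ ∞ (inCoords (tr (α ^ k * γ⁻¹))) orthant ∧
      ∃ p : unipotentLocus, σ₁ p.1 = 1 / 2 ∧ τ₁ p.1 = 1 ∧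
        (∀ q : unipotentLocus, q ≠ p → tr (α ^ k * γ⁻¹) p.1 < tr (α ^ k * γ⁻¹) q.1) ∧
        (∃! Φ, IsHamiltonianFlow (tr (α ^ k * γ⁻¹)) Φ) ∧
        ∀ Φ, IsHamiltonianFlow (tr (α ^ k * γ⁻¹)) Φ →
          (∀ x, ∃ T > 0, Function.Periodic (fun t => Φ t x) T) ∧
          ∀ x, (∀ t, Φ t x = x) ↔ x = p) := by
  refine ⟨⟨coords_injective, range_coords, exists_hol_eq⟩, mem_unipotentLocus_iff,
    ⟨contDiffOn_tr_commutator, ?_⟩, fun k hk => ⟨contDiffOn_tr_pow k, ?_⟩⟩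
  · have h33 : 0 < (Real.sqrt 33 - 1) / 16 := by
      have : 1 < Real.sqrt 33 := by
        rw [Real.lt_sqrt zero_le_one]
        norm_num
      linarith
    simpa only [Real.exp_zero, Real.exp_log h33] using
      exists_center contDiffOn_tr_commutator isRadial_tr_commutator
  · simpa only [Real.exp_zero, Real.exp_log (one_half_pos (α := ℝ))] using
      exists_center (contDiffOn_tr_pow k) (isRadial_tr_pow hk)
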